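/- \textbf{Notation.} An MV-algebra is an algebra $(A,\oplus,\neg,0)$ such that $(A,\oplus,0)$ is a commutative monoid, $\neg\neg x=x$, $x\oplus\neg 0=\neg 0$ and $\neg(\neg x\oplus y)\oplus y=\neg(\neg y\oplus x)\oplus x$; the standard one is $[0,1]$ with $x\oplus y=\min(1,x+y)$ and $\neg x=1-x$. Let $\mathcal M([0,1]^n)$ be the MV-algebra, with pointwise operations, of all continuous functions $f\colon[0,1]^n\to[0,1]$ that are piecewise affine with finitely many pieces, each with integer coefficients; for $P\subseteq[0,1]^n$ let $\mathcal M(P)=\{f|_P : f\in\mathcal M([0,1]^n)\}$. A $\mathbb Z$-retract of $[0,1]^n$ is the range of an idempotent map $\sigma\colon[0,1]^n\to[0,1]^n$ all of whose components lie in $\mathcal M([0,1]^n)$. A retraction of $\mathcal M([0,1]^n)$ onto a subalgebra $A$ is an idempotent endomorphism of $\mathcal M([0,1]^n)$ with range $A$; if one exists, $A$ is called a retract, and its multiplicity $\mathsf r(A)\in\{1,2,\ldots\}\cup\{\infty\}$ is the number of retractions of $\mathcal M([0,1]^n)$ onto $A$. For a finitely generated projective MV-algebra $B$, with $k$ its smallest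 number of generators, the index is $$\iota(B)=\sup\{\mathsf r(A) : A \text{ is a retract of } \mathcal M([0,1]^k),\ A\cong B\}.$$ The maximal spectral space $\mu_B$ is the set of maximal ideals of $B$ with the hull-kernel topology. One says that $\mu_B$ is a closed domain in $[0,1]^n$ if $B\cong\mathcal M(P)$ for some $\mathbb Z$-retract $P$ of $[0,1]^n$ that is homeomorphic to $\mu_B$ and equals the closure of its interior in $[0,1]^n$. \textbf{Theorem.} (i) For every $j=1,2,\dots$ there is a retract $A_j$ of $\mathcal M([0,1]^2)$ whose maximal spectral space is a closed domain in $[0,1]^2$ and whose index is a finite integer with $j<\iota(A_j)$. (ii) Let $F_1=F_2=1$, $F_{n+1}=F_n+F_{n-1}$ be the Fibonacci numbers, and for $n=1,2,\dots$ let $U_n\subseteq[0,1]^2$ be the triangle with vertices $(0,0)$, $\left(\tfrac1{F_n},0\right)$ and $\left(\tfrac n{F_{n+1}},\tfrac1{F_{n+1}}\right)$. Then $U_n$ is a $\mathbb Z$-retract of $[0,1]^2$ and $2^n\le\iota(\mathcal M(U_n))<\infty$. -/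

import Mathlib

open Set

/-! ## MV-algebras -/

/-- An MV-algebra `(A, ⊕, ¬, 0)`. -/
class MVAlgebra (A : Type*) where
  oplus : A → A → A
  neg : A → A
  zero : A
  oplus_assoc : ∀ x y z, oplus (oplus x y) z = oplus x (oplus y z)
  oplus_comm : ∀ x y, oplus x y = oplus y x
  oplus_zero : ∀ x, oplus x zero = x
  neg_neg : ∀ x, neg (neg x) = x
  oplus_neg_zero : ∀ x, oplus x (neg zero) = neg zero
  lukasiewicz : ∀ x y, oplus (neg (oplus (neg x) y)) y = oplus (neg (oplus (neg y) x)) x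

namespace MVAlgebra

/-- The natural order of an MV-algebra: `x ≤ y` iff `¬x ⊕ y = 1`, where `1 = ¬0`. -/
def le {A : Type*} [MVAlgebra A] (x y : A) : Prop := oplus (neg x) y = neg (zero : A)

/-- The standard MV-algebra `[0,1]`, with `x ⊕ y = min (1, x + y)` and `¬x = 1 - x`. -/
noncomputable instance instUnitInterval : MVAlgebra unitInterval where
  oplus x y := ⟨min 1 ((x : ℝ) + y), le_min zero_le_one (add_nonneg x.2.1 y.2.1), min_le_left _ _⟩
  neg x := ⟨1 - (x : ℝ), sub_nonneg.2 x.2.2, sub_le_self _ x.2.1⟩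
  zero := 0
  oplus_assoc x y z := by
    have hx := x.2.1; have hy := y.2.1; have hz := z.2.1
    apply Subtype.ext
    simp only [min_def]
    split_ifs <;> linarith
  oplus_comm x y := by
    apply Subtype.ext
    simp only [add_comm]
  oplus_zero x := by
    apply Subtype.ext
    simpa using x.2.2
  neg_neg x := by
    apply Subtype.ext
    simp
  oplus_neg_zero x := by
    apply Subtype.ext
    simpa using x.2.1
  lukasiewicz x y := by
    have hx := x.2; have hy := y.2
    apply Subtype.ext
    simp only [min_def]
    obtain ⟨hx0, hx1⟩ := hx
    obtain ⟨hy0, hy1⟩ := hy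
    split_ifs <;> linarith

/-- Functions into an MV-algebra, with pointwise operations. -/
instance instPi {X A : Type*} [MVAlgebra A] : MVAlgebra (X → A) where
  oplus f g := fun x => oplus (f x) (g x)
  neg f := fun x => neg (f x)
  zero := fun _ => zero
  oplus_assoc f g h := funext fun x => oplus_assoc (f x) (g x) (h x)
  oplus_comm f g := funext fun x => oplus_comm (f x) (g x)
  oplus_zero f := funext fun x => oplus_zero (f x)
  neg_neg f := funext fun x => neg_neg (f x)
  oplus_neg_zero f := funext fun x => oplus_neg_zero (f x)
  lukasiewicz f g := funext fun x => lukasiewicz (f x) (g x)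

end MVAlgebra

open MVAlgebra in
/-- Subalgebras of an MV-algebra. -/
structure MVSubalgebra (A : Type*) [MVAlgebra A] where
  carrier : Set A
  zero_mem : zero ∈ carrier
  oplus_mem : ∀ {x y}, x ∈ carrier → y ∈ carrier → oplus x y ∈ carrier
  neg_mem : ∀ {x}, x ∈ carrier → neg x ∈ carrier

namespace MVSubalgebra

open MVAlgebra

instance instSetLike {A : Type*} [MVAlgebra A] : SetLike (MVSubalgebra A) A where
  coe := carrier
  coe_injective S T h := by cases S; cases T; congr

/-- A subalgebra is an MV-algebra under the restricted operations. -/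
instance instMVAlgebra {A : Type*} [MVAlgebra A] (S : MVSubalgebra A) : MVAlgebra S where
  oplus x y := ⟨oplus x.1 y.1, S.oplus_mem x.2 y.2⟩
  neg x := ⟨neg x.1, S.neg_mem x.2⟩
  zero := ⟨zero, S.zero_mem⟩
  oplus_assoc x y z := Subtype.ext (oplus_assoc x.1 y.1 z.1)
  oplus_comm x y := Subtype.ext (oplus_comm x.1 y.1)
  oplus_zero x := Subtype.ext (oplus_zero x.1)
  neg_neg x := Subtype.ext (neg_neg x.1)
  oplus_neg_zero x := Subtype.ext (oplus_neg_zero x.1)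
  lukasiewicz x y := Subtype.ext (lukasiewicz x.1 y.1)

end MVSubalgebra

open MVAlgebra in
/-- Homomorphisms of MV-algebras. -/
@[ext]
structure MVHom (A B : Type*) [MVAlgebra A] [MVAlgebra B] where
  toFun : A → B
  map_zero : toFun zero = zero
  map_oplus : ∀ x y, toFun (oplus x y) = oplus (toFun x) (toFun y)
  map_neg : ∀ x, toFun (neg x) = neg (toFun x)

/-- Two MV-algebras are isomorphic if there is a bijective homomorphism between them. -/
def MVIsomorphic (A B : Type*) [MVAlgebra A] [MVAlgebra B] : Prop :=
  ∃ f : MVHom A B, Function.Bijective f.toFun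

/-- The subset `s` generates `B`: every subalgebra containing `s` is all of `B`. -/
def MVGenerates {B : Type*} [MVAlgebra B] (s : Set B) : Prop :=
  ∀ S : MVSubalgebra B, s ⊆ S → ∀ b : B, b ∈ S

/-- The smallest number of generators of a finitely generated MV-algebra `B`. -/
noncomputable def minGenerators (B : Type*) [MVAlgebra B] : ℕ :=
  sInf {k : ℕ | ∃ s : Finset B, s.card = k ∧ MVGenerates (s : Set B)}

/-! ## The maximal spectral space -/

/-- An ideal of an MV-algebra: it contains `0`, is closed under `⊕` and downward closed. -/
def IsMVIdeal {A : Type*} [MVAlgebra A] (J : Set A) : Prop :=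
  MVAlgebra.zero ∈ J ∧ (∀ x ∈ J, ∀ y ∈ J, MVAlgebra.oplus x y ∈ J) ∧
    ∀ x y, MVAlgebra.le x y → y ∈ J → x ∈ J

/-- The maximal spectral space `μ_A`: the set of maximal (proper) ideals of `A`. -/
def MaxSpec (A : Type*) [MVAlgebra A] : Type _ :=
  {J : Set A // Maximal (fun I : Set A => IsMVIdeal I ∧ I ≠ univ) J}

/-- The spectral (hull-kernel) topology, generated by the sets `{M | a ∉ M}`. -/
instance MaxSpec.instTopologicalSpace (A : Type*) [MVAlgebra A] :
    TopologicalSpace (MaxSpec A) :=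
  TopologicalSpace.generateFrom {U | ∃ a : A, U = {M : MaxSpec A | a ∉ M.1}}

/-- Kuratowski closed domains of a topological space. -/
def IsClosedDomain {X : Type*} [TopologicalSpace X] (D : Set X) : Prop :=
  closure (interior D) = D

/-! ## McNaughton functions and `ℤ`-retractions -/

/-- The unit cube `[0,1]^n`. -/
abbrev Cube (n : ℕ) : Type := Fin n → unitInterval

/-- McNaughton functions, i.e. `[0,1]`-valued `ℤ`-maps on `[0,1]^n`: continuous functions made of
finitely many affine pieces, each with integer coefficients. -/
def IsMcNaughton {n : ℕ} (f : Cube n → unitInterval) : Prop :=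
  Continuous f ∧ ∃ L : Finset ((Fin n → ℤ) × ℤ), ∀ x : Cube n, ∃ p ∈ L,
    (f x : ℝ) = ∑ i, (p.1 i : ℝ) * (x i : ℝ) + (p.2 : ℝ)

/-- The MV-algebra `M([0,1]^n)` of McNaughton functions on `[0,1]^n`. -/
def McN (n : ℕ) : MVSubalgebra (Cube n → unitInterval) where
  carrier := {f | IsMcNaughton f}
  zero_mem := ⟨continuous_const, {(0, 0)}, fun x => ⟨(0, 0), by simp, by
    simp [MVAlgebra.zero]⟩⟩
  oplus_mem := by
    classical
    rintro f g ⟨hf, L, hL⟩ ⟨hg, K, hK⟩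
    refine ⟨?_, insert (0, 1) ((L ×ˢ K).image fun q => q.1 + q.2), fun x => ?_⟩
    · exact Continuous.subtype_mk (continuous_const.min
        ((continuous_subtype_val.comp hf).add (continuous_subtype_val.comp hg))) _
    · obtain ⟨p, hp, hfp⟩ := hL x
      obtain ⟨q, hq, hgq⟩ := hK x
      change ∃ r ∈ _, min 1 ((f x : ℝ) + g x) = _
      rcases le_total (1 : ℝ) ((f x : ℝ) + g x) with h | h
      · exact ⟨(0, 1), Finset.mem_insert_self _ _, by simp [min_eq_left h]⟩
      · refine ⟨p + q, Finset.mem_insert_of_mem (Finset.mem_image.2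
          ⟨(p, q), Finset.mem_product.2 ⟨hp, hq⟩, rfl⟩), ?_⟩
        rw [min_eq_right h, hfp, hgq]
        simp only [Prod.fst_add, Prod.snd_add, Pi.add_apply, Int.cast_add, add_mul,
          Finset.sum_add_distrib]
        ring
  neg_mem := by
    classical
    rintro f ⟨hf, L, hL⟩
    refine ⟨?_, L.image fun q => (-q.1, 1 - q.2), fun x => ?_⟩
    · exact Continuous.subtype_mk (continuous_const.sub (continuous_subtype_val.comp hf)) _
    · obtain ⟨p, hp, hfp⟩ := hL x
      refine ⟨(-p.1, 1 - p.2), Finset.mem_image.2 ⟨p, hp, rfl⟩, ?_⟩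
      change 1 - (f x : ℝ) = _
      rw [hfp]
      simp only [Pi.neg_apply, Int.cast_neg, neg_mul, Finset.sum_neg_distrib, Int.cast_sub,
        Int.cast_one]
      ring

/-- The MV-algebra `M(P)` of restrictions to `P ⊆ [0,1]^n` of the elements of `M([0,1]^n)`. -/
def McNOn {n : ℕ} (P : Set (Cube n)) : MVSubalgebra (P → unitInterval) where
  carrier := {g | ∃ f ∈ McN n, g = P.domRestrict f}
  zero_mem := ⟨_, (McN n).zero_mem, rfl⟩
  oplus_mem := by
    rintro _ _ ⟨f, hf, rfl⟩ ⟨g, hg, rfl⟩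
    exact ⟨_, (McN n).oplus_mem hf hg, rfl⟩
  neg_mem := by
    rintro _ ⟨f, hf, rfl⟩
    exact ⟨_, (McN n).neg_mem hf, rfl⟩

/-- `σ` is a `ℤ`-retraction of `[0,1]^n`: an idempotent `ℤ`-map of `[0,1]^n` into itself. -/
def IsZRetraction {n : ℕ} (σ : Cube n → Cube n) : Prop :=
  (∀ i, IsMcNaughton fun x => σ x i) ∧ ∀ x, σ (σ x) = σ x

/-- `P` is a `ℤ`-retract of `[0,1]^n`: the range of a `ℤ`-retraction. -/
def IsZRetract {n : ℕ} (P : Set (Cube n)) : Prop :=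
  ∃ σ : Cube n → Cube n, IsZRetraction σ ∧ range σ = P

/-- "The maximal spectral space of `B` is a closed domain in `[0,1]^n`": `B ≅ M(P)` for some
`ℤ`-retract `P` of `[0,1]^n` that is a closed domain in `[0,1]^n` and is homeomorphic to the space
of maximal ideals of `B`. -/
def MaxSpecIsClosedDomain (n : ℕ) (B : Type*) [MVAlgebra B] : Prop :=
  ∃ P : Set (Cube n), IsZRetract P ∧ MVIsomorphic B (McNOn P) ∧ IsClosedDomain P ∧
    Nonempty (MaxSpec B ≃ₜ P)

/-! ## Retracts, multiplicity and index -/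

/-- The retractions of `M([0,1]^n)` onto its subalgebra `A`: the idempotent endomorphisms of
`M([0,1]^n)` with range `A`. -/
def retractionsOnto {n : ℕ} (A : MVSubalgebra (McN n)) : Set (MVHom (McN n) (McN n)) :=
  {ε | (∀ f, ε.toFun (ε.toFun f) = ε.toFun f) ∧ range ε.toFun = (A : Set (McN n))}

/-- `A` is a retract of `M([0,1]^n)`. -/
def IsRetract {n : ℕ} (A : MVSubalgebra (McN n)) : Prop :=
  (retractionsOnto A).Nonempty

/-- The multiplicity of a retract `A` of `M([0,1]^n)`: the number of retractions onto `A`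
(`⊤` if there are infinitely many). -/
noncomputable def retractMultiplicity {n : ℕ} (A : MVSubalgebra (McN n)) : ℕ∞ :=
  (retractionsOnto A).encard

/-- The index of a finitely generated projective MV-algebra `B`: the supremum of the
multiplicities of all retracts `A ≅ B` of `M([0,1]^k)`, with `k` the smallest number of
generators of `B`. -/
noncomputable def mvIndex (B : Type*) [MVAlgebra B] : ℕ∞ :=
  ⨆ (A : MVSubalgebra (McN (minGenerators B))) (_ : IsRetract A) (_ : MVIsomorphic A B),
    retractMultiplicity A

/-! ## The Fibonacci triangles -/

/-- The rational point of the plane with homogeneous integer coordinates `[a, b, d]`. -/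
noncomputable def homPoint (a b d : ℕ) : Fin 2 → ℝ := ![(a : ℝ) / d, (b : ℝ) / d]

/-- The triangle `U_n = conv([0,0,1], [1,0,F_n], [n,1,F_{n+1}])` (a subset of `[0,1]^2`
for `n ≥ 1`), where `F_n` is the `n`-th Fibonacci number, `F_1 = F_2 = 1`. -/
def fibTriangle (n : ℕ) : Set (Cube 2) :=
  {x | (fun i => (x i : ℝ)) ∈ convexHull ℝ
    {homPoint 0 0 1, homPoint 1 0 (Nat.fib n), homPoint n 1 (Nat.fib (n + 1))}}

/-!
A retraction of the free algebra `M([0,1]^n)` is composition with a `ℤ`-retraction of the cube,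
because a homomorphism from an algebra of continuous functions on a compact space to `[0,1]` is the
evaluation at some point (`MVHom.exists_eq_eval`). If `A ≅ M(P)` is realised by `g ↦ g ∘ τ` with
`τ : [0,1]^2 → P`, the retractions onto `A` correspond to the sections of `τ` whose components are
McNaughton functions (`exists_section_of_mem_retractionsOnto`).

*Finiteness.* A section is a continuous injective piecewise affine map, hence open at interior
points of `P` (`IsPiecewiseAffineOn.image_mem_nhds`). If two sections agree at such a point, the
images of its neighbourhoods overlap, and applying `τ` shows that the sections agree nearby; by
connectedness they are equal (`IsPiecewiseAffineOn.eqOn_of_leftInverse`). So a section is determined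
by its value at one interior rational point, of denominator `d` say. That value lies in
`(1/d) ℤ^2`, which leaves at most `(d + 1)^2` sections, whatever the retract `A ≅ M(P)`
(`retractMultiplicity_le`).

*Lower bound.* The map `(a, b) ↦ (|a - b|, min a b)` folds the quadrant onto itself and has the two
linear sections `(a, b) ↦ (a + b, b)` and `(a, b) ↦ (b, a + b)`. Its `n`-th iterate therefore has
`2 ^ n` linear sections, one for each cone at depth `n` of the Stern–Brocot tree. Since the entries
of a generator of such a cone are at most `F_n` or `F_{n+1}`, each section maps the triangle
`F_n a + F_{n+1} b ≤ 1` of the quadrant into the unit square. Folding `n` times and clipping to that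
triangle thus gives a map of the square with `2 ^ n` sections, and the section
`(a, b) ↦ (a + n b, b)` has image `fibTriangle n`.

The smallest number of generators of `M(fibTriangle n)` is `2`: McNaughton's theorem
(`IsMcNaughton.mem_of_coord_mem`) bounds it from above, and a one-dimensional Borsuk–Ulam argument
from below. The retracts `fibRetract n ≅ M(fibTriangle n)` serve for the first claim as well.
-/

/-! ### Homomorphisms, isomorphisms and generators -/

namespace MVAlgebra

theorem coe_oplus (x y : unitInterval) : ((oplus x y : unitInterval) : ℝ) = min 1 ((x : ℝ) + y) :=
  rfl

theorem coe_neg (x : unitInterval) : ((neg x : unitInterval) : ℝ) = 1 - x := rfl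

theorem coe_zero : ((zero : unitInterval) : ℝ) = 0 := rfl

theorem pi_oplus_apply {X : Type*} (f g : X → unitInterval) (x : X) :
    oplus f g x = oplus (f x) (g x) := rfl

theorem pi_neg_apply {X : Type*} (f : X → unitInterval) (x : X) : neg f x = neg (f x) := rfl

theorem pi_zero_apply {X : Type*} (x : X) : (zero : X → unitInterval) x = 0 := rfl

end MVAlgebra

open MVAlgebra

namespace MVHom

variable {A B C : Type*} [MVAlgebra A] [MVAlgebra B] [MVAlgebra C]

/-- The composite `g ∘ f` of two homomorphisms. -/
def comp (g : MVHom B C) (f : MVHom A B) : MVHom A C where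
  toFun x := g.toFun (f.toFun x)
  map_zero := by rw [f.map_zero, g.map_zero]
  map_oplus x y := by rw [f.map_oplus, g.map_oplus]
  map_neg x := by rw [f.map_neg, g.map_neg]

/-- The inverse of a bijective homomorphism. -/
noncomputable def inverse (f : MVHom A B) (hf : Function.Bijective f.toFun) : MVHom B A where
  toFun := (Equiv.ofBijective f.toFun hf).symm
  map_zero := by
    rw [Equiv.symm_apply_eq]
    exact f.map_zero.symm
  map_oplus x y := by
    rw [Equiv.symm_apply_eq]
    simp only [Equiv.ofBijective_apply, f.map_oplus]
    rw [Equiv.ofBijective_apply_symm_apply f.toFun hf,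
      Equiv.ofBijective_apply_symm_apply f.toFun hf]
  map_neg x := by
    rw [Equiv.symm_apply_eq]
    simp only [Equiv.ofBijective_apply, f.map_neg]
    rw [Equiv.ofBijective_apply_symm_apply f.toFun hf]

theorem apply_inverse (f : MVHom A B) (hf : Function.Bijective f.toFun) (b : B) :
    f.toFun ((f.inverse hf).toFun b) = b :=
  Equiv.ofBijective_apply_symm_apply f.toFun hf b

theorem inverse_apply (f : MVHom A B) (hf : Function.Bijective f.toFun) (a : A) :
    (f.inverse hf).toFun (f.toFun a) = a :=
  Equiv.ofBijective_symm_apply_apply f.toFun hf a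

theorem inverse_bijective (f : MVHom A B) (hf : Function.Bijective f.toFun) :
    Function.Bijective (f.inverse hf).toFun :=
  (Equiv.ofBijective f.toFun hf).symm.bijective

/-- The inclusion of a subalgebra. -/
def subtype (S : MVSubalgebra A) : MVHom S A := ⟨Subtype.val, rfl, fun _ _ => rfl, fun _ => rfl⟩

/-- Evaluation of unit-interval valued functions at a point. -/
def eval {X : Type*} (x : X) : MVHom (X → unitInterval) unitInterval :=
  ⟨fun f => f x, rfl, fun _ _ => rfl, fun _ => rfl⟩

/-- The preimage of a subalgebra under a homomorphism. -/
def comap (f : MVHom A B) (S : MVSubalgebra B) : MVSubalgebra A where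
  carrier := {a | f.toFun a ∈ S}
  zero_mem := by
    change f.toFun zero ∈ S
    rw [f.map_zero]; exact S.zero_mem
  oplus_mem {x y} hx hy := by
    change f.toFun (oplus x y) ∈ S
    rw [f.map_oplus]; exact S.oplus_mem hx hy
  neg_mem {x} hx := by
    change f.toFun (neg x) ∈ S
    rw [f.map_neg]; exact S.neg_mem hx

/-- The range of a homomorphism, as a subalgebra. -/
def mvRange (f : MVHom A B) : MVSubalgebra B where
  carrier := range f.toFun
  zero_mem := ⟨_, f.map_zero⟩
  oplus_mem := by
    rintro _ _ ⟨x, rfl⟩ ⟨y, rfl⟩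
    exact ⟨_, f.map_oplus x y⟩
  neg_mem := by
    rintro _ ⟨x, rfl⟩
    exact ⟨_, f.map_neg x⟩

end MVHom

namespace MVIsomorphic

variable {A B C : Type*} [MVAlgebra A] [MVAlgebra B] [MVAlgebra C]

theorem refl (A : Type*) [MVAlgebra A] : MVIsomorphic A A :=
  ⟨⟨id, rfl, fun _ _ => rfl, fun _ => rfl⟩, Function.bijective_id⟩

theorem symm : MVIsomorphic A B → MVIsomorphic B A := fun ⟨f, hf⟩ =>
  ⟨f.inverse hf, f.inverse_bijective hf⟩

theorem trans : MVIsomorphic A B → MVIsomorphic B C → MVIsomorphic A C :=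
  fun ⟨f, hf⟩ ⟨g, hg⟩ => ⟨g.comp f, hg.comp hf⟩

end MVIsomorphic

/-! ### Ideals and homomorphisms of algebras of continuous functions -/

/-- The `k`-fold sum `b ⊕ ⋯ ⊕ b`. -/
def mvMultiple {B : Type*} [MVAlgebra B] (b : B) : ℕ → B
  | 0 => zero
  | k + 1 => oplus (mvMultiple b k) b

section Compact

variable {X B : Type*} [MVAlgebra B]

theorem MVHom.apply_mvMultiple (e : MVHom B (X → unitInterval)) (b : B) (x : X) (k : ℕ) :
    (e.toFun (mvMultiple b k) x : ℝ) = min 1 (k * (e.toFun b x : ℝ)) := by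
  have h0 := (e.toFun b x).2.1
  induction k with
  | zero => simp [mvMultiple, e.map_zero, pi_zero_apply]
  | succ k ih =>
    simp only [mvMultiple, e.map_oplus, pi_oplus_apply, coe_oplus, ih]
    push_cast
    simp only [min_def]
    split_ifs <;> linarith

theorem IsMVIdeal.mvMultiple_mem {J : Set B} (hJ : IsMVIdeal J) {b : B} (hb : b ∈ J) (k : ℕ) :
    mvMultiple b k ∈ J := by
  induction k with
  | zero => exact hJ.1
  | succ k ih => exact hJ.2.1 _ ih _ hb

theorem IsMVIdeal.eq_univ {J : Set B} (hJ : IsMVIdeal J) (h1 : neg zero ∈ J) : J = univ :=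
  eq_univ_of_forall fun b => hJ.2.2 b _ (oplus_neg_zero _) h1

theorem oplus_eq_zero_iff {a b : unitInterval} : oplus a b = 0 ↔ a = 0 ∧ b = 0 := by
  have ha := a.2.1
  have hb := b.2.1
  simp only [Subtype.ext_iff, coe_oplus, Icc.coe_zero] at *
  constructor
  · intro h
    rcases min_choice 1 ((a : ℝ) + b) with h' | h' <;> rw [h'] at h
    · norm_num at h
    · constructor <;> linarith
  · rintro ⟨h, h'⟩
    simp [h, h']

/-- The kernel of a homomorphism to `[0,1]` is an ideal. -/
theorem MVHom.isMVIdeal_ker (h : MVHom B unitInterval) : IsMVIdeal {b | h.toFun b = 0} := by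
  refine ⟨h.map_zero, fun a ha b hb => ?_, fun a b hab hb => ?_⟩
  · simp only [mem_ofPred_eq, h.map_oplus, oplus_eq_zero_iff] at *
    exact ⟨ha, hb⟩
  · have := congrArg h.toFun hab
    simp only [mem_ofPred_eq] at hb
    rw [h.map_oplus, h.map_neg, h.map_neg, h.map_zero, hb] at this
    have := congrArg Subtype.val this
    simp only [coe_oplus, coe_neg, coe_zero, Icc.coe_zero] at this
    have h0 := (h.toFun a).2.1
    rw [min_eq_right (by linarith)] at this
    apply Subtype.ext
    simp only [Icc.coe_zero]
    linarith

theorem MVHom.ker_ne_univ (h : MVHom B unitInterval) : {b | h.toFun b = 0} ≠ univ := fun hu => by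
  have : (neg zero : B) ∈ {b | h.toFun b = 0} := hu ▸ mem_univ _
  simp only [mem_ofPred_eq, h.map_neg, h.map_zero] at this
  have := congrArg Subtype.val this
  simp [coe_neg, coe_zero] at this

variable [TopologicalSpace X] [CompactSpace X]

/-- Were there no common zero, compactness would give an element of the ideal without zeros; a
multiple of it is the constant `1`. -/
theorem IsMVIdeal.exists_common_zero {e : MVHom B (X → unitInterval)}
    (hc : ∀ b, Continuous (e.toFun b)) (hinj : Function.Injective e.toFun) {J : Set B}
    (hJ : IsMVIdeal J) (hne : J ≠ univ) : ∃ x, ∀ b ∈ J, e.toFun b x = 0 := by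
  have hcl : ∀ b, IsClosed {x | e.toFun b x = 0} := fun b =>
    isClosed_singleton.preimage (hc b)
  have : Nonempty J := ⟨⟨zero, hJ.1⟩⟩
  have hdir : Directed (fun s t : Set X => s ⊇ t) fun b : J => {x | e.toFun b x = 0} := by
    intro a b
    refine ⟨⟨oplus a.1 b.1, hJ.2.1 _ a.2 _ b.2⟩, fun x hx => ?_, fun x hx => ?_⟩ <;>
    · simp only [mem_ofPred_eq, e.map_oplus, pi_oplus_apply, oplus_eq_zero_iff] at hx
      first | exact hx.1 | exact hx.2
  have hnon : ∀ b : J, {x | e.toFun b x = 0}.Nonempty := by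
    rintro ⟨b, hb⟩
    by_contra hemp
    rw [not_nonempty_iff_eq_empty] at hemp
    have hpos : ∀ x, 0 < (e.toFun b x : ℝ) := fun x =>
      lt_of_le_of_ne (e.toFun b x).2.1 fun h => by
        have : x ∈ {x | e.toFun b x = 0} := Subtype.ext h.symm
        rw [hemp] at this
        exact this
    apply hne
    apply hJ.eq_univ
    rcases isEmpty_or_nonempty X with hX | hX
    · rw [hinj (funext fun x => hX.elim x : e.toFun (neg zero) = e.toFun b)]
      exact hb
    obtain ⟨x₀, -, hx₀⟩ := isCompact_univ.exists_isMinOn univ_nonempty (hc b).continuousOn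
    obtain ⟨k, hk⟩ := exists_nat_ge (1 / (e.toFun b x₀ : ℝ))
    have : mvMultiple b k = neg zero := by
      apply hinj
      funext x
      apply Subtype.ext
      rw [e.apply_mvMultiple, e.map_neg, e.map_zero, pi_neg_apply, coe_neg, pi_zero_apply]
      rw [div_le_iff₀ (hpos x₀)] at hk
      have hle : (e.toFun b x₀ : ℝ) ≤ e.toFun b x := hx₀ (mem_univ x)
      have : (k : ℝ) * (e.toFun b x₀ : ℝ) ≤ k * e.toFun b x := by gcongr
      rw [min_eq_left (by linarith)]
      simp
    rw [← this]
    exact hJ.mvMultiple_mem hb k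
  obtain ⟨x, hx⟩ := IsCompact.nonempty_iInter_of_directed_nonempty_isCompact_isClosed
    (fun b : J => {x | e.toFun b x = 0}) hdir hnon (fun b => (hcl b).isCompact) (fun b => hcl b)
  exact ⟨x, fun b hb => mem_iInter.1 hx ⟨b, hb⟩⟩

/-- A homomorphism to `[0,1]` from an algebra of continuous functions on a compact space is the
evaluation at some point. The kernel has a common zero `x`; a function whose image under `h`
differed from its value at `x` could be doubled (via `f ⊕ f` or `f ⊙ f`) until one of the two
numbers is `0` and the other is not. -/
theorem MVHom.exists_eq_eval {S : MVSubalgebra (X → unitInterval)}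
    (hc : ∀ f ∈ S, Continuous f) (h : MVHom S unitInterval) :
    ∃ x, ∀ f : S, h.toFun f = f.1 x := by
  obtain ⟨x, hx⟩ := IsMVIdeal.exists_common_zero (e := MVHom.subtype S)
    (J := {f | h.toFun f = 0}) (fun b => hc _ b.2) Subtype.val_injective
    h.isMVIdeal_ker h.ker_ne_univ
  have key : ∀ (k : ℕ) (f : S), (h.toFun f : ℝ) < f.1 x →
      2 ^ k * ((f.1 x : ℝ) - h.toFun f) ≤ 1 := by
    intro k
    induction k with
    | zero =>
      intro f _
      have h1 := (f.1 x).2.2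
      have h2 := (h.toFun f).2.1
      simp only [pow_zero, one_mul]
      linarith
    | succ k ih =>
      intro f hf
      have hdouble : (h.toFun (oplus f f) : ℝ) = min 1 ((h.toFun f : ℝ) + h.toFun f) := by
        rw [h.map_oplus, coe_oplus]
      have hdouble' : ((oplus f f : S).1 x : ℝ) = min 1 ((f.1 x : ℝ) + f.1 x) := rfl
      have hsq : (h.toFun (neg (oplus (neg f) (neg f))) : ℝ) =
          1 - min 1 ((1 - h.toFun f : ℝ) + (1 - h.toFun f)) := by
        rw [h.map_neg, h.map_oplus, h.map_neg, coe_neg, coe_oplus, coe_neg]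
      have hsq' : ((neg (oplus (neg f) (neg f)) : S).1 x : ℝ) =
          1 - min 1 ((1 - f.1 x : ℝ) + (1 - f.1 x)) := rfl
      rcases le_total (f.1 x : ℝ) (1 / 2) with hb | hb
      · rw [min_eq_right (by linarith)] at hdouble hdouble'
        have := ih (oplus f f) (by linarith)
        rw [hdouble, hdouble'] at this
        rw [pow_succ]
        linarith
      · rw [min_eq_right (by linarith)] at hsq'
        rcases le_total (1 / 2) (h.toFun f : ℝ) with ha | ha
        · rw [min_eq_right (by linarith)] at hsq
          have := ih (neg (oplus (neg f) (neg f))) (by linarith)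
          rw [hsq, hsq'] at this
          rw [pow_succ]
          linarith
        · rw [min_eq_left (by linarith)] at hsq
          have h0 := hx (neg (oplus (neg f) (neg f)))
            (Subtype.ext (by rw [hsq, sub_self, Icc.coe_zero]))
          have h0 := congrArg Subtype.val h0
          change ((neg (oplus (neg f) (neg f)) : S).1 x : ℝ) = 0 at h0
          rw [hsq'] at h0
          have : (f.1 x : ℝ) = 1 / 2 := by linarith
          have h00 : (0 : ℝ) ≤ h.toFun f := (h.toFun f).2.1
          rw [min_eq_right (by linarith)] at hdouble hdouble'
          have := ih (oplus f f) (by linarith)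
          rw [hdouble, hdouble'] at this
          rw [pow_succ]
          linarith
  have hle : ∀ f : S, (f.1 x : ℝ) ≤ h.toFun f := by
    intro f
    by_contra hlt
    push Not at hlt
    obtain ⟨k, hk⟩ := pow_unbounded_of_one_lt (1 / ((f.1 x : ℝ) - h.toFun f)) one_lt_two
    rw [div_lt_iff₀ (by linarith)] at hk
    linarith [key k f hlt]
  refine ⟨x, fun f => Subtype.ext (le_antisymm ?_ (hle f))⟩
  have := hle (neg f)
  rw [h.map_neg, coe_neg] at this
  have hneg : ((neg f : S).1 x : ℝ) = 1 - f.1 x := rfl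
  rw [hneg] at this
  linarith

/-- If the functions of the algebra separate points from closed sets, then `x ↦ {b | b x = 0}` is
a homeomorphism onto the maximal spectral space. -/
theorem nonempty_maxSpec_homeomorph {e : MVHom B (X → unitInterval)}
    (hc : ∀ b, Continuous (e.toFun b)) (hinj : Function.Injective e.toFun)
    [T1Space X] (hsep : ∀ (x : X) (V : Set X), IsOpen V → x ∈ V →
      ∃ b, e.toFun b x ≠ 0 ∧ ∀ y ∉ V, e.toFun b y = 0) :
    Nonempty (MaxSpec B ≃ₜ X) := by
  have hid : ∀ x, IsMVIdeal {b | e.toFun b x = 0} := fun x =>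
    ((MVHom.eval x).comp e).isMVIdeal_ker
  have hprop : ∀ x, {b | e.toFun b x = 0} ≠ univ := fun x => ((MVHom.eval x).comp e).ker_ne_univ
  have hinj' : ∀ x y, {b | e.toFun b x = 0} ⊆ {b | e.toFun b y = 0} → x = y := by
    intro x y hxy
    by_contra hne
    obtain ⟨b, hb, hb'⟩ := hsep y {x}ᶜ isOpen_compl_singleton (fun h => hne h.symm)
    exact hb (hxy (hb' x (fun h => h rfl)))
  have hmax : ∀ x, Maximal (fun I : Set B => IsMVIdeal I ∧ I ≠ univ) {b | e.toFun b x = 0} := by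
    refine fun x => ⟨⟨hid x, hprop x⟩, fun I hI hle => ?_⟩
    obtain ⟨y, hy⟩ := hI.1.exists_common_zero hc hinj hI.2
    have hxy := hinj' x y (fun b hb => hy b (hle hb))
    subst hxy
    exact hy
  let Φ : X → MaxSpec B := fun x => ⟨{b | e.toFun b x = 0}, hmax x⟩
  have hbij : Function.Bijective Φ := by
    refine ⟨fun x y hxy => hinj' x y (congrArg Subtype.val hxy).le, fun M => ?_⟩
    obtain ⟨x, hx⟩ := M.2.1.1.exists_common_zero hc hinj M.2.1.2
    refine ⟨x, Subtype.ext ?_⟩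
    exact (M.2.eq_of_le ⟨hid x, hprop x⟩ hx).symm
  have hcont : Continuous Φ := by
    refine continuous_generateFrom_iff.2 ?_
    rintro _ ⟨a, rfl⟩
    exact (isClosed_singleton.preimage (hc a)).isOpen_compl
  have hopen : IsOpenMap Φ := by
    intro V hV
    rw [isOpen_iff_mem_nhds]
    rintro _ ⟨x, hx, rfl⟩
    obtain ⟨b, hb, hb'⟩ := hsep x V hV hx
    have hO : IsOpen {M : MaxSpec B | b ∉ M.1} :=
      TopologicalSpace.isOpen_generateFrom_of_mem ⟨b, rfl⟩
    refine Filter.mem_of_superset (hO.mem_nhds (show b ∉ (Φ x).1 from hb)) fun M hM => ?_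
    obtain ⟨y, rfl⟩ := hbij.2 M
    refine ⟨y, ?_, rfl⟩
    by_contra hy
    exact hM (hb' y hy)
  exact ⟨((Equiv.ofBijective Φ hbij).toHomeomorphOfContinuousOpen hcont hopen).symm⟩

end Compact

/-! ### Integral piecewise linear functions -/

/-- Real-valued continuous functions on the cube with finitely many affine pieces, each with
integer coefficients. -/
def IsZPL {n : ℕ} (f : Cube n → ℝ) : Prop :=
  Continuous f ∧ ∃ L : Finset ((Fin n → ℤ) × ℤ), ∀ x : Cube n, ∃ p ∈ L,
    f x = ∑ i, (p.1 i : ℝ) * (x i : ℝ) + (p.2 : ℝ)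

theorem isMcNaughton_iff {n : ℕ} {f : Cube n → unitInterval} :
    IsMcNaughton f ↔ IsZPL fun x => (f x : ℝ) :=
  and_congr_left' ⟨fun h => continuous_subtype_val.comp h, fun h => Continuous.subtype_mk h _⟩

namespace IsZPL

variable {n : ℕ} {f g : Cube n → ℝ}

theorem intCast (m : ℤ) : IsZPL fun _ : Cube n => (m : ℝ) :=
  ⟨continuous_const, {(0, m)}, fun x => ⟨(0, m), by simp, by simp⟩⟩

theorem zero : IsZPL fun _ : Cube n => (0 : ℝ) := by simpa using intCast (n := n) 0

theorem one : IsZPL fun _ : Cube n => (1 : ℝ) := by simpa using intCast (n := n) 1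

theorem coord (i : Fin n) : IsZPL fun x : Cube n => (x i : ℝ) :=
  ⟨by fun_prop, {(Pi.single i 1, 0)}, fun x => ⟨_, Finset.mem_singleton_self _, by
    simp [Pi.single_apply]⟩⟩

theorem add (hf : IsZPL f) (hg : IsZPL g) : IsZPL fun x => f x + g x := by
  classical
  obtain ⟨hf, L, hL⟩ := hf
  obtain ⟨hg, K, hK⟩ := hg
  refine ⟨hf.add hg, (L ×ˢ K).image fun q => q.1 + q.2, fun x => ?_⟩
  obtain ⟨p, hp, hfp⟩ := hL x
  obtain ⟨q, hq, hgq⟩ := hK x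
  refine ⟨p + q, Finset.mem_image.2 ⟨(p, q), Finset.mem_product.2 ⟨hp, hq⟩, rfl⟩, ?_⟩
  simp only [hfp, hgq]
  simp only [Prod.fst_add, Prod.snd_add, Pi.add_apply, Int.cast_add, add_mul,
    Finset.sum_add_distrib]
  ring

theorem const_mul (m : ℤ) (hf : IsZPL f) : IsZPL fun x => (m : ℝ) * f x := by
  classical
  obtain ⟨hf, L, hL⟩ := hf
  refine ⟨continuous_const.mul hf, L.image fun q => m • q, fun x => ?_⟩
  obtain ⟨p, hp, hfp⟩ := hL x
  refine ⟨m • p, Finset.mem_image_of_mem _ hp, ?_⟩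
  simp only [hfp]
  simp only [Prod.smul_fst, Prod.smul_snd, Pi.smul_apply, smul_eq_mul, Int.cast_mul, mul_add,
    Finset.mul_sum, mul_assoc]

theorem natCast_mul (m : ℕ) (hf : IsZPL f) : IsZPL fun x => (m : ℝ) * f x := by
  simpa using hf.const_mul m

theorem neg (hf : IsZPL f) : IsZPL fun x => -f x := by simpa using hf.const_mul (-1)

theorem sub (hf : IsZPL f) (hg : IsZPL g) : IsZPL fun x => f x - g x := by
  simpa [sub_eq_add_neg] using hf.add hg.neg

theorem max (hf : IsZPL f) (hg : IsZPL g) : IsZPL fun x => max (f x) (g x) := by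
  classical
  obtain ⟨hf, L, hL⟩ := hf
  obtain ⟨hg, K, hK⟩ := hg
  refine ⟨hf.max hg, L ∪ K, fun x => ?_⟩
  obtain ⟨p, hp, hfp⟩ := hL x
  obtain ⟨q, hq, hgq⟩ := hK x
  rcases max_choice (f x) (g x) with h | h <;> simp only [h]
  · exact ⟨p, Finset.mem_union_left _ hp, hfp⟩
  · exact ⟨q, Finset.mem_union_right _ hq, hgq⟩

theorem min (hf : IsZPL f) (hg : IsZPL g) : IsZPL fun x => min (f x) (g x) := by
  simpa [max_neg_neg] using (hf.neg.max hg.neg).neg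

theorem abs (hf : IsZPL f) : IsZPL fun x => |f x| := hf.max hf.neg

theorem isMcNaughton_projIcc (hf : IsZPL f) :
    IsMcNaughton fun x => projIcc (0 : ℝ) 1 zero_le_one (f x) := by
  rw [isMcNaughton_iff]
  simpa only [coe_projIcc] using zero.max (one.min hf)

/-- At a rational point, an integral piecewise linear function takes a value whose denominator
divides that of the point. -/
theorem exists_int_eq (hf : IsZPL f) {x : Cube n} {d : ℕ} (m : Fin n → ℤ)
    (hx : ∀ i, (d : ℝ) * x i = m i) : ∃ k : ℤ, (d : ℝ) * f x = k := by
  obtain ⟨p, -, hp⟩ := hf.2.choose_spec x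
  refine ⟨∑ i, p.1 i * m i + d * p.2, ?_⟩
  rw [hp, mul_add, Finset.mul_sum]
  push_cast
  congr 1
  refine Finset.sum_congr rfl fun i _ => ?_
  rw [← hx i]
  ring

end IsZPL

/-! ### The coordinate functions generate the algebra of McNaughton functions -/

/-- A continuous selection from finitely many affine functions on `[0,1]` has a piece lying below
it at `0` and above it at `1`. After tilting by `ε` the function crosses its chord upwards, and
the piece in force just after the last crossing will do. -/
theorem exists_piece_le_and_ge {ι : Type*} (L : Finset ι) (α β : ι → ℝ) {F : ℝ → ℝ}
    (hF : Continuous F) (hL : ∀ t ∈ Icc (0 : ℝ) 1, ∃ j ∈ L, F t = α j + t * β j) :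
    ∃ j ∈ L, α j ≤ F 0 ∧ F 1 ≤ α j + β j := by
  have key : ∀ ε > 0, ∃ j ∈ L, α j ≤ F 0 + ε ∧ F 1 - ε ≤ α j + β j := by
    intro ε hε
    let g : ℝ → ℝ := fun t => F t - (F 0 + t * (F 1 - F 0)) + ε * (2 * t - 1)
    have hg : Continuous g := by fun_prop
    have hg0 : g 0 = -ε := by simp [g]
    have hg1 : g 1 = ε := by simp [g]; ring
    have hK : IsCompact {t | t ∈ Icc (0 : ℝ) 1 ∧ g t ≤ 0} :=
      isCompact_Icc.inter_right (isClosed_le hg continuous_const)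
    obtain ⟨s, ⟨hs, hgs⟩, hmax⟩ := hK.exists_isMaxOn
      ⟨0, ⟨le_rfl, zero_le_one⟩, by rw [hg0]; linarith⟩ continuousOn_id
    have hs1 : s < 1 := lt_of_le_of_ne hs.2 fun h => by rw [h, hg1] at hgs; linarith
    have hpos : ∀ t ∈ Ioc s 1, 0 < g t := by
      intro t ht
      by_contra h
      push Not at h
      have : t ≤ s := hmax ⟨⟨hs.1.trans ht.1.le, ht.2⟩, h⟩
      linarith [ht.1]
    -- one piece is used arbitrarily close to `s` on the right
    have hfreq : ∃ᶠ t in nhdsWithin s (Ioi s), ∃ j ∈ L, F t = α j + t * β j := by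
      refine Filter.Eventually.frequently ?_
      filter_upwards [Ioc_mem_nhdsGT hs1] with t ht using hL t ⟨hs.1.trans ht.1.le, ht.2⟩
    obtain ⟨j, hj, hfj⟩ : ∃ j ∈ L, ∃ᶠ t in nhdsWithin s (Ioi s), F t = α j + t * β j := by
      by_contra! h
      apply hfreq
      filter_upwards [(Finset.eventually_all L).2 h] with t ht
      rintro ⟨j, hj, h'⟩
      exact ht j hj h'
    have hFs : F s = α j + s * β j := by
      have hcl : IsClosed {t | F t = α j + t * β j} := isClosed_eq hF (by fun_prop)
      exact hcl.closure_subset ((hfj.filter_mono nhdsWithin_le_nhds).mem_closure)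
    obtain ⟨t, hFt, ht⟩ := (hfj.and_eventually (Ioc_mem_nhdsGT hs1)).exists
    have hgt := hpos t ht
    simp only [g] at hgs hgt
    rw [hFt] at hgt
    rw [hFs] at hgs
    have hst := ht.1
    have hs0 := hs.1
    -- the tilted piece `q` has `q s ≤ 0 < q t`, so it is increasing
    have hslope : 0 < β j - (F 1 - F 0) + 2 * ε := by
      by_contra h
      push Not at h
      nlinarith
    refine ⟨j, hj, ?_, ?_⟩
    · nlinarith
    · nlinarith [ht.2]
  by_contra! h
  have hpos : ∀ j ∈ L, ∃ ε > 0, ¬ (α j ≤ F 0 + ε ∧ F 1 - ε ≤ α j + β j) := by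
    intro j hj
    rcases le_or_gt (α j) (F 0) with h1 | h1
    · have := h j hj h1
      exact ⟨(F 1 - (α j + β j)) / 2, by linarith, fun h => by linarith [h.2]⟩
    · exact ⟨(α j - F 0) / 2, by linarith, fun h => by linarith [h.1]⟩
  choose! ε hε hε' using hpos
  obtain ⟨j₀, hj₀, -⟩ := key 1 one_pos
  obtain ⟨j₁, hj₁, hmin⟩ := L.exists_min_image ε ⟨j₀, hj₀⟩
  obtain ⟨j, hj, hj1, hj2⟩ := key (ε j₁) (hε j₁ hj₁)
  exact hε' j hj ⟨by linarith [hmin j hj], by linarith [hmin j hj]⟩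

/-- Truncation of the reals to the unit interval. -/
noncomputable abbrev clamp (t : ℝ) : unitInterval := projIcc 0 1 zero_le_one t

theorem coe_clamp (t : ℝ) : (clamp t : ℝ) = max 0 (min 1 t) := coe_projIcc _ _ _ _

theorem clamp_coe (t : unitInterval) : clamp (t : ℝ) = t := projIcc_val _ _

namespace MVSubalgebra

variable {X : Type*} (S : MVSubalgebra (X → unitInterval))

theorem sup_mem {f g : X → unitInterval} (hf : f ∈ S) (hg : g ∈ S) : f ⊔ g ∈ S := by
  have : f ⊔ g = oplus (neg (oplus (neg f) g)) g := by
    funext x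
    have h0 := (f x).2.2
    have h1 := (g x).2.1
    rcases le_total (f x) (g x) with h | h <;> apply Subtype.ext <;>
      have h' : (_ : ℝ) ≤ _ := h <;>
      simp only [Pi.sup_apply, pi_oplus_apply, coe_oplus, pi_neg_apply, MVAlgebra.coe_neg, h,
        sup_of_le_right, sup_of_le_left]
    · rw [min_eq_left (a := 1) (b := 1 - (f x : ℝ) + g x) (by linarith), sub_self, zero_add,
        min_eq_right (g x).2.2]
    · rw [min_eq_right (a := 1) (b := 1 - (f x : ℝ) + g x) (by linarith),
        min_eq_right (by linarith)]
      ring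
  rw [this]
  exact S.oplus_mem (S.neg_mem (S.oplus_mem (S.neg_mem hf) hg)) hg

theorem inf_mem {f g : X → unitInterval} (hf : f ∈ S) (hg : g ∈ S) : f ⊓ g ∈ S := by
  have : f ⊓ g = neg (neg f ⊔ neg g) := by
    funext x
    rcases le_total (f x) (g x) with h | h <;> apply Subtype.ext <;>
      have h' : (_ : ℝ) ≤ _ := h
    · have h2 : neg (g x) ≤ neg (f x) := Subtype.coe_le_coe.1 (by
        rw [MVAlgebra.coe_neg, MVAlgebra.coe_neg]; linarith)
      simp only [Pi.inf_apply, Pi.sup_apply, pi_neg_apply, MVAlgebra.coe_neg, inf_of_le_left h,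
        sup_of_le_left h2]
      ring
    · have h2 : neg (f x) ≤ neg (g x) := Subtype.coe_le_coe.1 (by
        rw [MVAlgebra.coe_neg, MVAlgebra.coe_neg]; linarith)
      simp only [Pi.inf_apply, Pi.sup_apply, pi_neg_apply, MVAlgebra.coe_neg, inf_of_le_right h,
        sup_of_le_right h2]
      ring
  rw [this]
  exact S.neg_mem (S.sup_mem (S.neg_mem hf) (S.neg_mem hg))

theorem const_one_mem : (fun _ => 1 : X → unitInterval) ∈ S := by
  have : (fun _ => 1 : X → unitInterval) = neg zero := by
    funext x
    apply Subtype.ext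
    simp [pi_neg_apply, pi_zero_apply, MVAlgebra.coe_neg]
  rw [this]
  exact S.neg_mem S.zero_mem

/-- The real functions all of whose integer translates belong to `S` after truncation. -/
def ClampMem (g : X → ℝ) : Prop := ∀ m : ℤ, (fun x => clamp (g x + m)) ∈ S

variable {S}

theorem ClampMem.zero : S.ClampMem fun _ => 0 := by
  intro m
  rcases le_or_gt m 0 with h | h
  · have : (fun _ : X => clamp (0 + m)) = MVAlgebra.zero := funext fun x =>
      projIcc_of_le_left _ (by simpa using (by exact_mod_cast h : (m : ℝ) ≤ 0))
    exact this ▸ S.zero_mem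
  · have : (fun _ : X => clamp (0 + m)) = fun _ => 1 := funext fun x =>
      projIcc_of_right_le _ (by simpa using (by exact_mod_cast h : (1 : ℝ) ≤ m))
    exact this ▸ S.const_one_mem

/-- Adding an element of `S` uses the identity
`clamp (t + y) = (clamp t ⊕ y) ⊙ clamp (t + 1)` for `y ∈ [0,1]`. -/
theorem ClampMem.add {g : X → ℝ} (hg : S.ClampMem g) {y : X → unitInterval} (hy : y ∈ S) :
    S.ClampMem fun x => g x + y x := by
  intro m
  have : (fun x => clamp (g x + y x + m)) =
      neg (oplus (neg (oplus (fun x => clamp (g x + m)) y))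
        (neg fun x => clamp (g x + (m + 1 : ℤ)))) := by
    funext x
    apply Subtype.ext
    have h0 := (y x).2.1
    have h1 := (y x).2.2
    simp only [pi_oplus_apply, pi_neg_apply, MVAlgebra.coe_neg, coe_oplus, coe_clamp]
    push_cast
    simp only [min_def, max_def]
    split_ifs <;> linarith
  rw [this]
  exact S.neg_mem (S.oplus_mem (S.neg_mem (S.oplus_mem (hg m) hy)) (S.neg_mem (hg (m + 1))))

theorem ClampMem.sub {g : X → ℝ} (hg : S.ClampMem g) {y : X → unitInterval} (hy : y ∈ S) :
    S.ClampMem fun x => g x - y x := by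
  intro m
  convert (hg.add (S.neg_mem hy)) (m - 1) using 2 with x
  simp only [pi_neg_apply, MVAlgebra.coe_neg]
  push_cast
  congr 1
  ring

theorem ClampMem.add_int_mul {g : X → ℝ} (hg : S.ClampMem g) {y : X → unitInterval} (hy : y ∈ S)
    (c : ℤ) : S.ClampMem fun x => g x + c * y x := by
  induction c using Int.induction_on with
  | zero => simpa using hg
  | succ k ih =>
    convert ih.add hy using 2
    push_cast; ring
  | pred k ih =>
    convert ih.sub hy using 2
    push_cast; ring

theorem ClampMem.sum {ι : Type*} (s : Finset ι) (c : ι → ℤ) {y : ι → X → unitInterval}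
    (hy : ∀ i, y i ∈ S) : S.ClampMem fun x => ∑ i ∈ s, (c i : ℝ) * y i x := by
  classical
  induction s using Finset.induction_on with
  | empty => simpa using ClampMem.zero
  | insert i s hi ih =>
    convert ih.add_int_mul (hy i) (c i) using 2
    rw [Finset.sum_insert hi, add_comm]

end MVSubalgebra

/-- McNaughton's theorem: a subalgebra containing the coordinate functions contains every
McNaughton function, since such a function is a supremum of infima of its truncated affine
pieces. -/
theorem IsMcNaughton.mem_of_coord_mem {n : ℕ} {S : MVSubalgebra (Cube n → unitInterval)}
    (hS : ∀ i, (fun x => x i) ∈ S) {f : Cube n → unitInterval} (hf : IsMcNaughton f) : f ∈ S := by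
  classical
  obtain ⟨hfc, L, hL⟩ := hf
  let ℓ : (Fin n → ℤ) × ℤ → Cube n → ℝ := fun p x => ∑ i, (p.1 i : ℝ) * (x i : ℝ) + (p.2 : ℝ)
  let φ : (Fin n → ℤ) × ℤ → Cube n → unitInterval := fun p x => clamp (ℓ p x)
  have hφ : ∀ p, φ p ∈ S := fun p => MVSubalgebra.ClampMem.sum Finset.univ p.1 hS p.2
  have htwo : ∀ a b : Cube n, ∃ p ∈ L, ℓ p a ≤ f a ∧ (f b : ℝ) ≤ ℓ p b := by
    intro a b
    let γ : ℝ → Cube n := fun t i => clamp ((a i : ℝ) + t * ((b i : ℝ) - a i))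
    have hγ : Continuous γ := continuous_pi fun i => continuous_projIcc.comp (by fun_prop)
    have hγc : ∀ t ∈ Icc (0 : ℝ) 1, ∀ i, (γ t i : ℝ) = (a i : ℝ) + t * ((b i : ℝ) - a i) := by
      intro t ht i
      have ha := (a i).2
      have hb := (b i).2
      have ht' : (a i : ℝ) + t * ((b i : ℝ) - a i) ∈ Icc (0 : ℝ) 1 :=
        ⟨by nlinarith [ht.1, ht.2, ha.1, hb.1], by nlinarith [ht.1, ht.2, ha.2, hb.2]⟩
      exact congrArg Subtype.val (projIcc_of_mem zero_le_one ht')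
    have h0 : γ 0 = a := funext fun i => Subtype.ext (by rw [hγc 0 (by simp)]; ring)
    have h1 : γ 1 = b := funext fun i => Subtype.ext (by rw [hγc 1 (by simp)]; ring)
    obtain ⟨p, hp, hp0, hp1⟩ := exists_piece_le_and_ge L (fun p => ℓ p a)
      (fun p => ℓ p b - ℓ p a) (F := fun t => (f (γ t) : ℝ)) (by fun_prop) (fun t ht => by
        obtain ⟨p, hp, hfp⟩ := hL (γ t)
        refine ⟨p, hp, ?_⟩
        rw [hfp]
        simp only [hγc t ht, ℓ, mul_add, mul_sub, Finset.sum_add_distrib, Finset.sum_sub_distrib,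
          Finset.mul_sum, mul_left_comm t]
        ring)
    simp only [h0, h1] at hp0 hp1
    exact ⟨p, hp, hp0, by linarith⟩
  have hsup : f = (L.powerset.filter fun T => T.inf φ ≤ f).sup fun T => T.inf φ := by
    refine le_antisymm (fun b => ?_) (Finset.sup_le fun T hT => (Finset.mem_filter.1 hT).2)
    have hT : (L.filter fun p => (f b : ℝ) ≤ ℓ p b).inf φ ≤ f := by
      intro a
      obtain ⟨p, hp, hpa, hpb⟩ := htwo a b
      have h1 : (L.filter fun p => (f b : ℝ) ≤ ℓ p b).inf φ ≤ φ p :=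
        Finset.inf_le (Finset.mem_filter.2 ⟨hp, hpb⟩)
      refine (h1 a).trans ?_
      rw [← clamp_coe (f a)]
      exact monotone_projIcc _ hpa
    have h2 : (L.filter fun p => (f b : ℝ) ≤ ℓ p b).inf φ ≤
        (L.powerset.filter fun T => T.inf φ ≤ f).sup fun T => T.inf φ :=
      Finset.le_sup (f := fun T => T.inf φ)
        (Finset.mem_filter.2 ⟨Finset.mem_powerset.2 (Finset.filter_subset _ _), hT⟩)
    refine le_trans ?_ (h2 b)
    rw [Finset.inf_apply]
    refine Finset.le_inf fun p hp => ?_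
    rw [← clamp_coe (f b)]
    exact monotone_projIcc _ (Finset.mem_filter.1 hp).2
  rw [hsup]
  refine Finset.sup_induction S.zero_mem (fun _ h _ h' => S.sup_mem h h') fun T _ => ?_
  exact Finset.inf_induction S.const_one_mem (fun _ h _ h' => S.inf_mem h h') fun p _ => hφ p

/-- Precomposition with `σ`. -/
def MVHom.precomp {X Y : Type*} (σ : X → Y) : MVHom (Y → unitInterval) (X → unitInterval) :=
  ⟨fun f => f ∘ σ, rfl, fun _ _ => rfl, fun _ => rfl⟩

theorem IsMcNaughton.coord {n : ℕ} (i : Fin n) : IsMcNaughton fun x : Cube n => x i :=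
  isMcNaughton_iff.2 (IsZPL.coord i)

theorem IsMcNaughton.comp {n m : ℕ} {f : Cube m → unitInterval} (hf : IsMcNaughton f)
    {σ : Cube n → Cube m} (hσ : ∀ i, IsMcNaughton fun x => σ x i) : IsMcNaughton (f ∘ σ) :=
  IsMcNaughton.mem_of_coord_mem (S := (MVHom.precomp σ).comap (McN n)) hσ hf

/-- McNaughton functions separate points from closed sets: a tent of height `1` and width `2 / k`
around a point of denominator `k` that is `1 / (2 k)`-close to `x`. -/
theorem exists_isMcNaughton_ne_zero {n : ℕ} {V : Set (Cube n)} (hV : IsOpen V) {x : Cube n}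
    (hx : x ∈ V) : ∃ f, IsMcNaughton f ∧ f x ≠ 0 ∧ ∀ y ∉ V, f y = 0 := by
  obtain ⟨ε, hε, hball⟩ := Metric.isOpen_iff.1 hV x hx
  obtain ⟨k, hk⟩ := exists_nat_gt (2 / ε)
  have hk0 : (0 : ℝ) < k := (by positivity : (0 : ℝ) < 2 / ε).trans hk
  let t : Fin n → Cube n → ℝ := fun i y => 1 - |k * (y i : ℝ) - (round (k * (x i : ℝ)) : ℤ)|
  have ht : ∀ i, IsZPL (t i) := fun i =>
    IsZPL.one.sub (((IsZPL.coord i).natCast_mul k).sub (IsZPL.intCast _)).abs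
  have hinf : ∀ s : Finset (Fin n), IsMcNaughton fun y => s.inf fun i => clamp (t i y) := by
    intro s
    have : (fun y => s.inf fun i => clamp (t i y)) = s.inf fun i y => clamp (t i y) := by
      funext y; rw [Finset.inf_apply]
    rw [this]
    exact Finset.inf_induction (p := (· ∈ McN n)) (McN n).const_one_mem
      (fun _ h _ h' => (McN n).inf_mem h h') fun i _ => (ht i).isMcNaughton_projIcc
  refine ⟨_, hinf Finset.univ, ?_, fun y hy => ?_⟩
  · have : (⟨1 / 2, by norm_num, by norm_num⟩ : unitInterval) ≤
        Finset.univ.inf fun i => clamp (t i x) := by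
      refine Finset.le_inf fun i _ => ?_
      have h : (1 / 2 : ℝ) ≤ t i x := by
        have := abs_sub_round (k * (x i : ℝ))
        simp only [t]
        linarith
      rw [← Subtype.coe_le_coe, coe_clamp]
      exact le_max_of_le_right (le_min (by norm_num) h)
    intro h0
    rw [h0, ← Subtype.coe_le_coe] at this
    norm_num at this
  · by_contra h0
    apply hy
    apply hball
    rw [Metric.mem_ball, dist_pi_lt_iff hε]
    intro i
    have hi : 0 < t i y := by
      by_contra h
      push Not at h
      apply h0
      refine le_antisymm ?_ bot_le
      refine (Finset.inf_le (Finset.mem_univ i)).trans ?_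
      exact (projIcc_of_le_left zero_le_one h).le
    have hr := abs_sub_round (k * (x i : ℝ))
    have h2 : |(k : ℝ) * (y i : ℝ) - k * (x i : ℝ)| < 2 := by
      simp only [t] at hi
      rw [abs_le] at hr
      rw [sub_pos, abs_lt] at hi
      rw [abs_lt]
      constructor <;> linarith
    rw [← mul_sub, abs_mul, abs_of_pos hk0] at h2
    rw [Subtype.dist_eq, Real.dist_eq]
    rw [div_lt_iff₀ hε] at hk
    by_contra hge
    push Not at hge
    nlinarith

/-! ### Sections of planar piecewise linear maps are rigid -/

section Rigidity

open Filter Topology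

/-- A form of the one-dimensional Borsuk–Ulam theorem on a circle in the plane, with centre `c`
and radius `r`. -/
theorem exists_eq_antipodal {f : ℂ → ℝ} {c : ℂ} {r : ℝ}
    (hf : ContinuousOn f (Metric.sphere c r)) (hr : 0 < r) :
    ∃ v : ℂ, ‖v‖ = r ∧ f (c + v) = f (c - v) := by
  let γ : ℝ → ℂ := fun θ => r * Complex.exp (θ * Complex.I)
  have hγ : ∀ θ, ‖γ θ‖ = r := fun θ => by
    simp [γ, Complex.norm_exp_ofReal_mul_I, abs_of_pos hr]
  have hγc : Continuous γ := by fun_prop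
  have hc1 : Continuous fun θ => f (c + γ θ) := by
    refine hf.comp_continuous (by fun_prop) fun θ => ?_
    simp [hγ]
  have hc2 : Continuous fun θ => f (c - γ θ) := by
    refine hf.comp_continuous (by fun_prop) fun θ => ?_
    simp [hγ]
  have hπ : γ Real.pi = - γ 0 := by simp [γ, Complex.exp_pi_mul_I]
  have hk : Continuous fun θ => f (c + γ θ) - f (c - γ θ) := hc1.sub hc2
  have hsum : (f (c + γ Real.pi) - f (c - γ Real.pi)) = -(f (c + γ 0) - f (c - γ 0)) := by
    rw [hπ, sub_neg_eq_add, ← sub_eq_add_neg]; ring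
  have h0 : (0 : ℝ) ∈ uIcc (f (c + γ 0) - f (c - γ 0)) (f (c + γ Real.pi) - f (c - γ Real.pi)) := by
    rw [hsum, mem_uIcc]
    rcases le_total 0 (f (c + γ 0) - f (c - γ 0)) with h | h
    · right; constructor <;> linarith
    · left; constructor <;> linarith
  obtain ⟨θ, -, hθ⟩ := intermediate_value_uIcc (a := (0 : ℝ)) (b := Real.pi) hk.continuousOn h0
  exact ⟨γ θ, hγ θ, sub_eq_zero.1 hθ⟩

/-- If a direction field on a circle never agrees at two antipodal points, then it takes every
direction: otherwise its argument, measured from an omitted direction, would be a continuous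
function separating antipodes. -/
theorem exists_sameRay_of_antipodal {D : ℂ → ℂ} {r : ℝ} (hr : 0 < r)
    (hD : ContinuousOn D (Metric.sphere 0 r))
    (hanti : ∀ v, ‖v‖ = r → ¬ SameRay ℝ (D v) (D (-v))) {w : ℂ} (hw : w ≠ 0) :
    ∃ v, ‖v‖ = r ∧ SameRay ℝ w (D v) := by
  by_contra! hno
  have hslit : ∀ v, ‖v‖ = r → -(D v) / w ∈ Complex.slitPlane := by
    intro v hv
    by_contra hns
    rw [Complex.mem_slitPlane_iff] at hns
    push Not at hns
    obtain ⟨hre, him⟩ := hns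
    apply hno v hv
    have : D v = (-(-(D v) / w).re) • w := by
      have h1 : -(D v) / w = ((-(D v) / w).re : ℂ) := Complex.ext rfl (by simpa using him)
      rw [Complex.real_smul]
      push_cast
      rw [← h1]
      field_simp
    rw [this]
    exact SameRay.sameRay_nonneg_smul_right w (by linarith)
  obtain ⟨v, hv, hvv⟩ := exists_eq_antipodal (f := fun v => (-(D v) / w).arg) (c := 0)
    (fun v hv => ((Complex.continuousAt_arg (hslit v (by simpa using hv))).comp_continuousWithinAt
      (f := fun v => -(D v) / w) (((hD v hv).neg).div_const w))) hr
  rw [zero_add, zero_sub] at hvv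
  refine hanti v hv ?_
  have := (Complex.sameRay_of_arg_eq hvv).map (LinearMap.mulLeft ℝ (-w))
  simpa [mul_div_cancel₀, hw, mul_comm, mul_div_assoc] using this

/-- `S` agrees at each point of `Ω` with one of finitely many real affine maps. -/
def IsPiecewiseAffineOn (S : ℂ → ℂ) (Ω : Set ℂ) : Prop :=
  ∃ L : Finset ((ℂ →ₗ[ℝ] ℂ) × ℂ), ∀ z ∈ Ω, ∃ p ∈ L, S z = p.1 z + p.2

/-- Near each point, a continuous piecewise affine map is affine along every ray from that
point: only the pieces attaining the value at the point matter, and a continuous selection from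
finitely many velocities is constant. -/
theorem IsPiecewiseAffineOn.exists_homogeneous {S : ℂ → ℂ} {Ω : Set ℂ}
    (hS : IsPiecewiseAffineOn S Ω) (hc : ContinuousOn S Ω) (hΩ : IsOpen Ω) {x : ℂ} (hx : x ∈ Ω) :
    ∃ r > 0, Metric.closedBall x r ⊆ Ω ∧ ∀ v : ℂ, ‖v‖ ≤ r → ∀ t ∈ Icc (0 : ℝ) 1,
      S (x + t • v) - S x = t • (S (x + v) - S x) := by
  obtain ⟨L, hL⟩ := hS
  have hev : ∀ᶠ z in 𝓝 x, ∀ p ∈ L, p.1 x + p.2 ≠ S x → S z ≠ p.1 z + p.2 := by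
    rw [Finset.eventually_all]
    intro p _
    by_cases h : p.1 x + p.2 = S x
    · simp [h]
    · have h1 : ContinuousAt (fun z => p.1 z + p.2) x :=
        ((LinearMap.continuous_of_finiteDimensional p.1).add continuous_const).continuousAt
      have h2 : ContinuousAt S x := hc.continuousAt (hΩ.mem_nhds hx)
      filter_upwards [(h2.ne_iff_eventually_ne h1).1 (Ne.symm h)] with z hz _
      exact hz
  obtain ⟨r, hr, hball⟩ := Metric.nhds_basis_closedBall.mem_iff.1
    (inter_mem (hΩ.mem_nhds hx) hev)
  refine ⟨r, hr, fun z hz => (hball hz).1, fun v hv t ht => ?_⟩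
  have hmem : ∀ t ∈ Icc (0 : ℝ) 1, x + t • v ∈ Metric.closedBall x r := by
    intro t ht
    simp only [Metric.mem_closedBall, dist_self_add_left, norm_smul, Real.norm_eq_abs,
      abs_of_nonneg ht.1]
    calc t * ‖v‖ ≤ 1 * ‖v‖ := by gcongr; exact ht.2
      _ ≤ r := by rwa [one_mul]
  rcases ht.1.eq_or_lt with h0 | h0
  · simp [← h0]
  have hpiece : ∀ t ∈ Ioc (0 : ℝ) 1, t⁻¹ • (S (x + t • v) - S x) ∈
      (fun p : (ℂ →ₗ[ℝ] ℂ) × ℂ => p.1 v) '' (L : Set ((ℂ →ₗ[ℝ] ℂ) × ℂ)) := by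
    intro t ht
    have hz := hball (hmem t (Ioc_subset_Icc_self ht))
    obtain ⟨p, hp, hpz⟩ := hL _ hz.1
    have hpx : p.1 x + p.2 = S x := by
      by_contra h
      exact hz.2 p hp h hpz
    refine ⟨p, hp, ?_⟩
    simp only
    rw [hpz, ← hpx, map_add, map_smul]
    have : p.1 x + t • p.1 v + p.2 - (p.1 x + p.2) = t • p.1 v := by ring
    rw [this, smul_smul, inv_mul_cancel₀ ht.1.ne', one_smul]
  have hcont : ContinuousOn (fun t : ℝ => t⁻¹ • (S (x + t • v) - S x)) (Ioc 0 1) := by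
    refine ContinuousOn.smul (continuousOn_inv₀.mono fun t ht => ht.1.ne') ?_
    refine ContinuousOn.sub (hc.comp (by fun_prop) fun t ht => ?_) continuousOn_const
    exact (hball (hmem t (Ioc_subset_Icc_self ht))).1
  have := isPreconnected_Ioc.constant_of_mapsTo
    ((L.finite_toSet.image _).isDiscrete) hcont hpiece ⟨h0, ht.2⟩ ⟨one_pos, le_rfl⟩
  simp only [inv_one, one_smul] at this
  rw [← this, smul_smul, mul_inv_cancel₀ h0.ne', one_smul]

/-- Invariance of domain for planar piecewise affine maps: an injective one maps neighbourhoods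
to neighbourhoods. -/
theorem IsPiecewiseAffineOn.image_mem_nhds {S : ℂ → ℂ} {Ω : Set ℂ}
    (hS : IsPiecewiseAffineOn S Ω) (hc : ContinuousOn S Ω) (hinj : InjOn S Ω) (hΩ : IsOpen Ω)
    {x : ℂ} (hx : x ∈ Ω) : S '' Ω ∈ 𝓝 (S x) := by
  obtain ⟨r, hr, hball, hhom⟩ := hS.exists_homogeneous hc hΩ hx
  have hmem : ∀ v : ℂ, ‖v‖ ≤ r → x + v ∈ Ω := fun v hv => hball (by simpa using hv)
  have hmul : ∀ v : ℂ, ‖v‖ = r → ∀ t ∈ Icc (0 : ℝ) 1, ‖t • v‖ ≤ r := by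
    intro v hv t ht
    rw [norm_smul, Real.norm_eq_abs, abs_of_nonneg ht.1, hv]
    nlinarith [ht.2]
  let D : ℂ → ℂ := fun v => S (x + v) - S x
  have hD0 : ∀ v, ‖v‖ = r → D v ≠ 0 := by
    intro v hv h
    have := hinj (hmem v hv.le) hx (sub_eq_zero.1 h)
    have hv0 : v = 0 := by simpa using this
    rw [hv0, norm_zero] at hv
    exact hr.ne hv
  have hDc : ContinuousOn D (Metric.sphere 0 r) :=
    (hc.comp (by fun_prop) fun v hv => hmem v (by simpa using hv.le)).sub continuousOn_const
  -- Two points of the circle mapped in the same direction coincide, by homogeneity.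
  have hray : ∀ v w : ℂ, ‖v‖ = r → ‖w‖ = r → ∀ t ∈ Icc (0 : ℝ) 1, D v = t • D w → v = w := by
    intro v w hv hw t ht h
    have h1 : S (x + v) = S (x + t • w) := by
      have := hhom w hw.le t ht
      rw [← sub_left_inj (a := S x), this]
      exact h
    have h2 : v = t • w := by
      simpa using hinj (hmem v hv.le) (hmem _ (hmul w hw t ht)) h1
    have h3 : r = t * r := by
      conv_lhs => rw [← hv, h2, norm_smul, Real.norm_eq_abs, abs_of_nonneg ht.1, hw]
    have ht1 : t = 1 := by
      have : (t - 1) * r = 0 := by linarith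
      rcases mul_eq_zero.1 this with h | h
      · linarith
      · exact absurd h hr.ne'
    rw [h2, ht1, one_smul]
  have hanti : ∀ v, ‖v‖ = r → ¬ SameRay ℝ (D v) (D (-v)) := by
    intro v hv hsame
    have hv' : ‖-v‖ = r := by rwa [norm_neg]
    have hne : v ≠ -v := by
      intro h
      have : v = 0 := self_eq_neg.1 h
      rw [this, norm_zero] at hv
      exact hr.ne hv
    obtain ⟨t, ht, h⟩ := hsame.exists_nonneg_left (hD0 v hv)
    rcases le_total t 1 with h1 | h1
    · exact hne (hray (-v) v hv' hv t ⟨ht, h1⟩ h.symm).symm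
    · refine hne (hray v (-v) hv hv' t⁻¹ ⟨by positivity, inv_le_one_of_one_le₀ h1⟩ ?_)
      rw [← h, smul_smul, inv_mul_cancel₀ (by linarith), one_smul]
  obtain ⟨v₀, hv₀, hmin⟩ := (isCompact_sphere (0 : ℂ) r).exists_isMinOn
    (NormedSpace.sphere_nonempty.2 hr.le) hDc.norm
  have hv₀' : ‖v₀‖ = r := by simpa using hv₀
  have hm : 0 < ‖D v₀‖ := norm_pos_iff.2 (hD0 v₀ hv₀')
  refine mem_of_superset (Metric.ball_mem_nhds _ hm) fun y hy => ?_
  rcases eq_or_ne y (S x) with rfl | hne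
  · exact mem_image_of_mem S hx
  obtain ⟨v, hv, hsame⟩ := exists_sameRay_of_antipodal hr hDc hanti (sub_ne_zero.2 hne)
  obtain ⟨t, ht, h⟩ := hsame.exists_nonneg_right (hD0 v hv)
  have hle : ‖D v₀‖ ≤ ‖D v‖ := hmin (by simpa using hv)
  have ht1 : t ≤ 1 := by
    rw [Metric.mem_ball, dist_eq_norm, h, norm_smul, Real.norm_eq_abs, abs_of_nonneg ht] at hy
    by_contra hlt
    push Not at hlt
    nlinarith
  refine ⟨x + t • v, hmem _ (hmul v hv t ⟨ht, ht1⟩), ?_⟩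
  have := hhom v hv.le t ⟨ht, ht1⟩
  change _ = t • D v at this
  rw [← h] at this
  exact sub_left_injective this

/-- Two piecewise affine sections of one and the same map over a connected open set either agree
or are disjoint. -/
theorem IsPiecewiseAffineOn.eqOn_of_leftInverse {S S' T : ℂ → ℂ} {Ω : Set ℂ}
    (hS : IsPiecewiseAffineOn S Ω) (hc : ContinuousOn S Ω) (hc' : ContinuousOn S' Ω)
    (hT : ∀ z ∈ Ω, T (S z) = z) (hT' : ∀ z ∈ Ω, T (S' z) = z) (hΩ : IsOpen Ω)
    (hconn : IsPreconnected Ω) {x : ℂ} (hx : x ∈ Ω) (hxx : S x = S' x) : EqOn S S' Ω := by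
  have hinj : InjOn S Ω := fun z hz w hw h => by rw [← hT z hz, ← hT w hw, h]
  have hloc : ∀ z ∈ Ω, S z = S' z → ∀ᶠ w in 𝓝 z, S w = S' w := by
    intro z hz h
    have h1 : ∀ᶠ w in 𝓝 z, S' w ∈ S '' Ω :=
      (hc'.continuousAt (hΩ.mem_nhds hz)) (h ▸ hS.image_mem_nhds hc hinj hΩ hz)
    filter_upwards [h1, hΩ.mem_nhds hz] with w hw hwΩ
    obtain ⟨u, hu, huw⟩ := hw
    have : u = w := by rw [← hT u hu, huw, hT' w hwΩ]
    rw [← huw, this]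
  have hopen : IsOpen {z | z ∈ Ω ∧ S z ≠ S' z} := by
    rw [isOpen_iff_mem_nhds]
    rintro z ⟨hz, hne⟩
    filter_upwards [hΩ.mem_nhds hz, ((hc.continuousAt (hΩ.mem_nhds hz)).ne_iff_eventually_ne
      (hc'.continuousAt (hΩ.mem_nhds hz))).1 hne] with w hw hw'
    exact ⟨hw, hw'⟩
  have hsub := IsPreconnected.subset_left_of_subset_union
    (isOpen_interior (s := {z | S z = S' z})) hopen ?_ (fun z hz => ?_)
    ⟨x, hx, mem_interior_iff_mem_nhds.2 (hloc x hx hxx)⟩ hconn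
  · exact fun z hz => interior_subset (s := {z | S z = S' z}) (hsub hz)
  · rw [disjoint_left]
    exact fun z hz hz' => hz'.2 (interior_subset (s := {z | S z = S' z}) hz)
  · by_cases h : S z = S' z
    · exact Or.inl (mem_interior_iff_mem_nhds.2 (hloc z hz h))
    · exact Or.inr ⟨hz, h⟩

end Rigidity

/-! ### Folding the square onto a Fibonacci triangle -/

/-- The point of the square with the given coordinates, truncated to `[0,1]`. -/
noncomputable def planePoint (a b : ℝ) : Cube 2 := ![clamp a, clamp b]

theorem planePoint_zero {a : ℝ} (b : ℝ) (ha : a ∈ Icc (0 : ℝ) 1) : (planePoint a b 0 : ℝ) = a :=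
  congrArg Subtype.val (projIcc_of_mem zero_le_one ha)

theorem planePoint_one (a : ℝ) {b : ℝ} (hb : b ∈ Icc (0 : ℝ) 1) : (planePoint a b 1 : ℝ) = b :=
  congrArg Subtype.val (projIcc_of_mem zero_le_one hb)

theorem planePoint_coe (x : Cube 2) : planePoint (x 0) (x 1) = x := by
  funext i
  fin_cases i
  · exact clamp_coe (x 0)
  · exact clamp_coe (x 1)

theorem continuous_planePoint : Continuous fun p : ℝ × ℝ => planePoint p.1 p.2 := by
  refine continuous_pi fun i => ?_
  fin_cases i
  · exact (continuous_projIcc (h := zero_le_one)).comp continuous_fst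
  · exact (continuous_projIcc (h := zero_le_one)).comp continuous_snd

theorem continuous_complex_mk : Continuous fun p : ℝ × ℝ => (⟨p.1, p.2⟩ : ℂ) :=
  Complex.equivRealProdCLM.symm.continuous

/-- The fold of the quadrant along the diagonal, in the basis `(1,0), (1,1)`. It takes the
coordinates of a vector in a basis `P, Q` to those in whichever of the bases `P, P + Q` and
`Q, P + Q` spans a cone containing it. -/
def foldStep (p : ℝ × ℝ) : ℝ × ℝ := (|p.1 - p.2|, min p.1 p.2)

/-- The two linear sections of `foldStep`. -/
def unfoldStep (c : Bool) (p : ℝ × ℝ) : ℝ × ℝ := if c then (p.2, p.1 + p.2) else (p.1 + p.2, p.2)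

/-- The linear section of an iterated fold given by a word; its image is a cone of the
Stern–Brocot subdivision of the quadrant. -/
def unfoldWord (l : List Bool) (p : ℝ × ℝ) : ℝ × ℝ := l.foldr unfoldStep p

theorem unfoldWord_cons (c : Bool) (l : List Bool) (p : ℝ × ℝ) :
    unfoldWord (c :: l) p = unfoldStep c (unfoldWord l p) := rfl

theorem unfoldStep_nonneg {p : ℝ × ℝ} (hp : 0 ≤ p.1 ∧ 0 ≤ p.2) (c : Bool) :
    0 ≤ (unfoldStep c p).1 ∧ 0 ≤ (unfoldStep c p).2 := by
  obtain ⟨h1, h2⟩ := hp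
  cases c <;> simp only [unfoldStep, if_true, Bool.false_eq_true, if_false] <;>
    constructor <;> linarith

theorem unfoldWord_nonneg {p : ℝ × ℝ} (hp : 0 ≤ p.1 ∧ 0 ≤ p.2) (l : List Bool) :
    0 ≤ (unfoldWord l p).1 ∧ 0 ≤ (unfoldWord l p).2 := by
  induction l with
  | nil => exact hp
  | cons c l ih => exact unfoldStep_nonneg ih c

theorem foldStep_unfoldStep {p : ℝ × ℝ} (hp : 0 ≤ p.1) (c : Bool) :
    foldStep (unfoldStep c p) = p := by
  cases c <;> ext <;> simp [foldStep, unfoldStep, hp, abs_of_nonneg]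

theorem foldStep_iterate_unfoldWord {p : ℝ × ℝ} (hp : 0 ≤ p.1 ∧ 0 ≤ p.2) (l : List Bool) :
    foldStep^[l.length] (unfoldWord l p) = p := by
  induction l with
  | nil => rfl
  | cons c l ih =>
    rw [List.length_cons, Function.iterate_succ_apply, unfoldWord_cons,
      foldStep_unfoldStep (unfoldWord_nonneg hp l).1, ih]

theorem foldStep_iterate_nonneg {p : ℝ × ℝ} (hp : 0 ≤ p.1 ∧ 0 ≤ p.2) (n : ℕ) :
    0 ≤ (foldStep^[n] p).1 ∧ 0 ≤ (foldStep^[n] p).2 := by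
  induction n with
  | zero => exact hp
  | succ n ih =>
    rw [Function.iterate_succ_apply']
    exact ⟨abs_nonneg _, le_min ih.1 ih.2⟩

theorem unfoldWord_pos {p : ℝ × ℝ} (hp : 0 < p.1 ∧ 0 < p.2) (l : List Bool) :
    0 < (unfoldWord l p).1 ∧ 0 < (unfoldWord l p).2 := by
  induction l with
  | nil => exact hp
  | cons c l ih =>
    rw [unfoldWord_cons]
    obtain ⟨h1, h2⟩ := ih
    cases c <;> simp only [unfoldStep, if_true, Bool.false_eq_true, if_false] <;>
      constructor <;> linarith

/-- Distinct words of the same length move every interior point of the quadrant differently: the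
first letter tells which coordinate of the image is larger. -/
theorem unfoldWord_injective {p : ℝ × ℝ} (hp : 0 < p.1 ∧ 0 < p.2) :
    ∀ {l l' : List Bool}, l.length = l'.length → unfoldWord l p = unfoldWord l' p → l = l' := by
  intro l
  induction l with
  | nil => intro l' hl _; exact (List.length_eq_zero_iff.1 hl.symm).symm
  | cons c l ih =>
    intro l' hl h
    cases l' with
    | nil => simp at hl
    | cons c' l' =>
      rw [unfoldWord_cons, unfoldWord_cons] at h
      have h1 := unfoldWord_pos hp l
      have h2 := unfoldWord_pos hp l'
      have hcc : c = c' := by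
        cases c <;> cases c' <;> simp [unfoldStep, Prod.ext_iff] at h ⊢ <;> linarith
      subst hcc
      rw [ih (by simpa using hl) ?_]
      have := congrArg foldStep h
      rwa [foldStep_unfoldStep h1.1.le, foldStep_unfoldStep h2.1.le] at this

theorem unfoldWord_replicate_false (n : ℕ) (p : ℝ × ℝ) :
    unfoldWord (List.replicate n false) p = (p.1 + n * p.2, p.2) := by
  induction n with
  | zero => simp [unfoldWord]
  | succ n ih =>
    rw [List.replicate_succ, unfoldWord_cons, ih]
    simp [unfoldStep]
    ring

/-- The triangle with vertices `0`, `(1 / Fₙ, 0)` and `(0, 1 / Fₙ₊₁)`. -/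
def fibDomain (n : ℕ) : Set (ℝ × ℝ) :=
  {p | 0 ≤ p.1 ∧ 0 ≤ p.2 ∧ (Nat.fib n : ℝ) * p.1 + Nat.fib (n + 1) * p.2 ≤ 1}

theorem unfoldStep_mem_fibDomain {n : ℕ} {p : ℝ × ℝ} (hp : p ∈ fibDomain (n + 1)) (c : Bool) :
    unfoldStep c p ∈ fibDomain n := by
  obtain ⟨h1, h2, h3⟩ := hp
  obtain ⟨h4, h5⟩ := unfoldStep_nonneg ⟨h1, h2⟩ c
  refine ⟨h4, h5, ?_⟩
  have hfib : (Nat.fib (n + 1 + 1) : ℝ) = Nat.fib n + Nat.fib (n + 1) := by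
    exact_mod_cast Nat.fib_add_two
  have hle : (Nat.fib n : ℝ) ≤ Nat.fib (n + 1) := by exact_mod_cast Nat.fib_le_fib_succ
  rw [hfib] at h3
  cases c <;> simp only [unfoldStep, if_true, Bool.false_eq_true, if_false] <;>
    nlinarith [mul_le_mul_of_nonneg_right hle h1]

theorem unfoldWord_mem_fibDomain (l : List Bool) {n : ℕ} {p : ℝ × ℝ}
    (hp : p ∈ fibDomain (n + l.length)) : unfoldWord l p ∈ fibDomain n := by
  induction l generalizing n with
  | nil => exact hp
  | cons c l ih =>
    refine unfoldStep_mem_fibDomain (ih ?_) c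
    rwa [List.length_cons, ← add_assoc, add_right_comm] at hp

theorem unfoldWord_mem_Icc {l : List Bool} (hl : l ≠ []) {p : ℝ × ℝ}
    (hp : p ∈ fibDomain l.length) :
    (unfoldWord l p).1 ∈ Icc (0 : ℝ) 1 ∧ (unfoldWord l p).2 ∈ Icc (0 : ℝ) 1 := by
  cases l with
  | nil => exact absurd rfl hl
  | cons c l =>
    have h : unfoldWord l p ∈ fibDomain 1 :=
      unfoldWord_mem_fibDomain l (by rwa [List.length_cons, add_comm] at hp)
    obtain ⟨h1, h2, h3⟩ := h
    rw [Nat.fib_one, one_add_one_eq_two, Nat.fib_two, Nat.cast_one, one_mul, one_mul] at h3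
    rw [unfoldWord_cons]
    cases c <;> simp only [unfoldStep, if_true, Bool.false_eq_true, if_false, mem_Icc] <;>
      refine ⟨⟨?_, ?_⟩, ?_, ?_⟩ <;> linarith

/-- A retraction of the quadrant onto `fibDomain n`: both coordinates are lowered by the excess
`Fₙ a + Fₙ₊₁ b - 1`, if positive, and then truncated at `0`. -/
noncomputable def fibClip (n : ℕ) (p : ℝ × ℝ) : ℝ × ℝ :=
  (max 0 (p.1 - max 0 (Nat.fib n * p.1 + Nat.fib (n + 1) * p.2 - 1)),
    max 0 (p.2 - max 0 (Nat.fib n * p.1 + Nat.fib (n + 1) * p.2 - 1)))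

theorem fibClip_of_mem {n : ℕ} {p : ℝ × ℝ} (hp : p ∈ fibDomain n) : fibClip n p = p := by
  obtain ⟨h1, h2, h3⟩ := hp
  have : max 0 ((Nat.fib n : ℝ) * p.1 + Nat.fib (n + 1) * p.2 - 1) = 0 :=
    max_eq_left (by linarith)
  simp [fibClip, this, h1, h2]

theorem fibClip_mem {n : ℕ} (hn : 1 ≤ n) {p : ℝ × ℝ} (hp : 0 ≤ p.1 ∧ 0 ≤ p.2) :
    fibClip n p ∈ fibDomain n := by
  refine ⟨le_max_left _ _, le_max_left _ _, ?_⟩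
  have hF : (1 : ℝ) ≤ Nat.fib n := by exact_mod_cast Nat.fib_pos.2 hn
  have hF' : (1 : ℝ) ≤ Nat.fib (n + 1) := by exact_mod_cast Nat.fib_pos.2 n.succ_pos
  obtain ⟨h1, h2⟩ := hp
  simp only [fibClip]
  set F : ℝ := (Nat.fib n : ℝ)
  set F' : ℝ := (Nat.fib (n + 1) : ℝ)
  set u : ℝ := max 0 (F * p.1 + F' * p.2 - 1) with hu
  have hu0 : 0 ≤ u := le_max_left _ _
  have hu1 : F * p.1 + F' * p.2 - 1 ≤ u := le_max_right _ _
  have hFu : u ≤ F * u := le_mul_of_one_le_left hu0 hF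
  have hFu' : u ≤ F' * u := le_mul_of_one_le_left hu0 hF'
  have hp1 : 0 ≤ F * p.1 := by positivity
  have hp2 : 0 ≤ F' * p.2 := by positivity
  rcases le_total 0 (p.1 - u) with h | h <;> rcases le_total 0 (p.2 - u) with h' | h' <;>
    simp only [max_eq_left, max_eq_right, h, h', mul_sub, mul_zero] <;> linarith

/-- The coordinates in `fibDomain n` of the image of `x` under the `n`-fold fold. -/
noncomputable def foldCoord (n : ℕ) (x : Cube 2) : ℝ × ℝ :=
  fibClip n (foldStep^[n] ((x 0 : ℝ), (x 1 : ℝ)))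

theorem foldCoord_mem {n : ℕ} (hn : 1 ≤ n) (x : Cube 2) : foldCoord n x ∈ fibDomain n :=
  fibClip_mem hn (foldStep_iterate_nonneg ⟨(x 0).2.1, (x 1).2.1⟩ n)

/-- Fold the square onto `fibDomain n`, where `n` is the length of the word, then embed it back
by the linear section belonging to the word. -/
noncomputable def foldRetraction (l : List Bool) (x : Cube 2) : Cube 2 :=
  planePoint (unfoldWord l (foldCoord l.length x)).1 (unfoldWord l (foldCoord l.length x)).2

theorem foldCoord_planePoint_unfoldWord {l : List Bool} (hl : l ≠ []) {p : ℝ × ℝ}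
    (hp : p ∈ fibDomain l.length) :
    foldCoord l.length (planePoint (unfoldWord l p).1 (unfoldWord l p).2) = p := by
  obtain ⟨h1, h2⟩ := unfoldWord_mem_Icc hl hp
  rw [foldCoord, planePoint_zero _ h1, planePoint_one _ h2,
    foldStep_iterate_unfoldWord ⟨hp.1, hp.2.1⟩, fibClip_of_mem hp]

theorem foldRetraction_comp {l l' : List Bool} (hl : l' ≠ []) (hll : l.length = l'.length)
    (x : Cube 2) : foldRetraction l (foldRetraction l' x) = foldRetraction l x := by
  have : foldCoord l.length (foldRetraction l' x) = foldCoord l.length x := by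
    rw [hll, foldRetraction, foldCoord_planePoint_unfoldWord hl
      (foldCoord_mem (List.length_pos_iff.2 hl) x)]
  rw [foldRetraction, this, foldRetraction]

theorem isZPL_foldStep_iterate (n : ℕ) {h : Cube 2 → ℝ × ℝ}
    (hh : IsZPL (fun x => (h x).1) ∧ IsZPL fun x => (h x).2) :
    IsZPL (fun x => (foldStep^[n] (h x)).1) ∧ IsZPL fun x => (foldStep^[n] (h x)).2 := by
  induction n with
  | zero => exact hh
  | succ n ih =>
    simp only [Function.iterate_succ_apply']
    exact ⟨(ih.1.sub ih.2).abs, ih.1.min ih.2⟩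

theorem isZPL_foldCoord (n : ℕ) :
    IsZPL (fun x => (foldCoord n x).1) ∧ IsZPL fun x => (foldCoord n x).2 := by
  obtain ⟨h1, h2⟩ := isZPL_foldStep_iterate n
    (h := fun x : Cube 2 => ((x 0 : ℝ), (x 1 : ℝ))) ⟨IsZPL.coord 0, IsZPL.coord 1⟩
  have hu := IsZPL.zero.max
    (((h1.natCast_mul (Nat.fib n)).add (h2.natCast_mul (Nat.fib (n + 1)))).sub IsZPL.one)
  exact ⟨IsZPL.zero.max (h1.sub hu), IsZPL.zero.max (h2.sub hu)⟩

theorem isZPL_unfoldWord (l : List Bool) {h : Cube 2 → ℝ × ℝ}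
    (hh : IsZPL (fun x => (h x).1) ∧ IsZPL fun x => (h x).2) :
    IsZPL (fun x => (unfoldWord l (h x)).1) ∧ IsZPL fun x => (unfoldWord l (h x)).2 := by
  induction l with
  | nil => exact hh
  | cons c l ih =>
    cases c
    · exact ⟨ih.1.add ih.2, ih.2⟩
    · exact ⟨ih.2, ih.1.add ih.2⟩

theorem isZRetraction_foldRetraction {l : List Bool} (hl : l ≠ []) :
    IsZRetraction (foldRetraction l) := by
  obtain ⟨h1, h2⟩ := isZPL_unfoldWord l (isZPL_foldCoord l.length)
  refine ⟨fun i => ?_, foldRetraction_comp hl rfl⟩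
  fin_cases i
  · exact h1.isMcNaughton_projIcc
  · exact h2.isMcNaughton_projIcc

theorem foldRetraction_injective {l l' : List Bool} (hl : l ≠ []) (hll : l.length = l'.length)
    (h : foldRetraction l = foldRetraction l') : l = l' := by
  have hl' : l' ≠ [] := by
    rw [← List.length_pos_iff, ← hll]
    exact List.length_pos_iff.2 hl
  set n := l.length with hn
  have hF : (0 : ℝ) < Nat.fib n + Nat.fib (n + 1) := by
    have : 0 < Nat.fib (n + 1) := Nat.fib_pos.2 n.succ_pos
    positivity
  set ε : ℝ := 1 / (Nat.fib n + Nat.fib (n + 1)) with hε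
  have hε0 : 0 < ε := by positivity
  have hp : ((ε, ε) : ℝ × ℝ) ∈ fibDomain n := by
    refine ⟨hε0.le, hε0.le, ?_⟩
    rw [← add_mul, hε, mul_one_div_cancel hF.ne']
  have hx := congrFun h (planePoint (unfoldWord l (ε, ε)).1 (unfoldWord l (ε, ε)).2)
  obtain ⟨h1, h2⟩ := unfoldWord_mem_Icc hl hp
  obtain ⟨h1', h2'⟩ := unfoldWord_mem_Icc hl' (hll ▸ hp)
  rw [foldRetraction, foldRetraction, ← hll, ← hn, foldCoord_planePoint_unfoldWord hl hp] at hx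
  refine unfoldWord_injective (p := (ε, ε)) ⟨hε0, hε0⟩ hll (Prod.ext ?_ ?_)
  · have := congrArg (fun y : Cube 2 => (y 0 : ℝ)) hx
    simpa only [planePoint_zero _ h1, planePoint_zero _ h1'] using this
  · have := congrArg (fun y : Cube 2 => (y 1 : ℝ)) hx
    simpa only [planePoint_one _ h2, planePoint_one _ h2'] using this

theorem mem_fibTriangle_iff {n : ℕ} (hn : 1 ≤ n) (x : Cube 2) :
    x ∈ fibTriangle n ↔ ((x 0 : ℝ) - n * x 1, (x 1 : ℝ)) ∈ fibDomain n := by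
  have hF : (0 : ℝ) < Nat.fib n := by exact_mod_cast Nat.fib_pos.2 hn
  have hF' : (0 : ℝ) < Nat.fib (n + 1) := by exact_mod_cast Nat.fib_pos.2 n.succ_pos
  constructor
  · intro hx
    have hconv : Convex ℝ {v : Fin 2 → ℝ | (v 0 - n * v 1, v 1) ∈ fibDomain n} := by
      rintro v ⟨hv1, hv2, hv3⟩ w ⟨hw1, hw2, hw3⟩ a b ha hb hab
      simp only at hv1 hv2 hv3 hw1 hw2 hw3
      refine ⟨?_, ?_, ?_⟩ <;> simp only [Pi.add_apply, Pi.smul_apply, smul_eq_mul]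
      · linarith [mul_nonneg ha hv1, mul_nonneg hb hw1]
      · linarith [mul_nonneg ha hv2, mul_nonneg hb hw2]
      · linarith [mul_le_mul_of_nonneg_left hv3 ha, mul_le_mul_of_nonneg_left hw3 hb]
    refine convexHull_min ?_ hconv hx
    rintro _ (rfl | rfl | rfl) <;> simp [homPoint, fibDomain, hF.ne', hF'.ne', div_eq_mul_inv]
  · rintro ⟨h1, h2, h3⟩
    simp only at h1 h2 h3
    set a := (x 0 : ℝ) - n * x 1 with ha
    have hsum := (convex_convexHull ℝ
      {homPoint 0 0 1, homPoint 1 0 (Nat.fib n), homPoint n 1 (Nat.fib (n + 1))}).sum_mem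
      (t := Finset.univ) (w := ![1 - (Nat.fib n * a + Nat.fib (n + 1) * x 1), Nat.fib n * a,
        Nat.fib (n + 1) * x 1])
      (z := ![homPoint 0 0 1, homPoint 1 0 (Nat.fib n), homPoint n 1 (Nat.fib (n + 1))])
      (fun i _ => by
        fin_cases i
        · simpa using h3
        · simpa using by positivity
        · simpa using by positivity)
      (by simp [Fin.sum_univ_three]; ring)
      (fun i _ => subset_convexHull ℝ _ (by fin_cases i <;> simp))
    rw [fibTriangle, mem_ofPred_eq]
    convert hsum using 1
    funext i
    fin_cases i
    · simp [Fin.sum_univ_three, homPoint]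
      field_simp
      rw [ha]
      ring
    · simp [Fin.sum_univ_three, homPoint]
      field_simp

theorem range_foldRetraction_replicate {n : ℕ} (hn : 1 ≤ n) :
    range (foldRetraction (List.replicate n false)) = fibTriangle n := by
  have hl : List.replicate n false ≠ [] := by
    rw [← List.length_pos_iff, List.length_replicate]
    exact hn
  ext x
  constructor
  · rintro ⟨y, rfl⟩
    have hq := foldCoord_mem hn y
    have hmem := unfoldWord_mem_Icc hl (p := foldCoord n y) (by rwa [List.length_replicate])
    rw [mem_fibTriangle_iff hn, foldRetraction, List.length_replicate,
      planePoint_zero _ hmem.1, planePoint_one _ hmem.2, unfoldWord_replicate_false]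
    simpa using hq
  · intro hx
    rw [mem_fibTriangle_iff hn] at hx
    refine ⟨x, ?_⟩
    have h := foldCoord_planePoint_unfoldWord hl
      (p := ((x 0 : ℝ) - n * x 1, (x 1 : ℝ))) (by rwa [List.length_replicate])
    have hu : unfoldWord (List.replicate n false) ((x 0 : ℝ) - n * x 1, (x 1 : ℝ)) =
        ((x 0 : ℝ), (x 1 : ℝ)) := by
      rw [unfoldWord_replicate_false]
      simp
    rw [hu, planePoint_coe] at h
    rw [foldRetraction, h, hu, planePoint_coe]

theorem isZRetract_fibTriangle {n : ℕ} (hn : 1 ≤ n) : IsZRetract (fibTriangle n) :=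
  ⟨_, isZRetraction_foldRetraction (by
    rw [← List.length_pos_iff, List.length_replicate]
    exact hn), range_foldRetraction_replicate hn⟩

/-! ### The interior of a Fibonacci triangle -/

/-- The open triangle underlying `fibTriangle n`, in the complex plane. -/
def openFibTriangle (n : ℕ) : Set ℂ :=
  {z | 0 < z.re - n * z.im ∧ 0 < z.im ∧
    (Nat.fib n : ℝ) * (z.re - n * z.im) + Nat.fib (n + 1) * z.im < 1}

theorem isOpen_openFibTriangle (n : ℕ) : IsOpen (openFibTriangle n) := by
  have h1 : Continuous fun z : ℂ => z.re - n * z.im := by fun_prop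
  have h3 : Continuous fun z : ℂ =>
      (Nat.fib n : ℝ) * (z.re - n * z.im) + Nat.fib (n + 1) * z.im := by fun_prop
  exact (isOpen_lt continuous_const h1).inter
    ((isOpen_lt continuous_const Complex.continuous_im).inter (isOpen_lt h3 continuous_const))

theorem convex_openFibTriangle (n : ℕ) : Convex ℝ (openFibTriangle n) := by
  rw [convex_iff_forall_pos]
  rintro v ⟨hv1, hv2, hv3⟩ w ⟨hw1, hw2, hw3⟩ a b ha hb hab
  refine ⟨?_, ?_, ?_⟩ <;> simp only [Complex.add_re, Complex.add_im, Complex.real_smul,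
    Complex.re_ofReal_mul, Complex.im_ofReal_mul]
  · linarith [mul_pos ha hv1, mul_pos hb hw1]
  · linarith [mul_pos ha hv2, mul_pos hb hw2]
  · linarith [mul_lt_mul_of_pos_left hv3 ha, mul_lt_mul_of_pos_left hw3 hb]

theorem mem_Icc_of_mem_openFibTriangle {n : ℕ} (hn : 1 ≤ n) {z : ℂ} (hz : z ∈ openFibTriangle n) :
    z.re ∈ Icc (0 : ℝ) 1 ∧ z.im ∈ Icc (0 : ℝ) 1 := by
  obtain ⟨h1, h2, h3⟩ := hz
  have hmem := unfoldWord_mem_Icc (l := List.replicate n false) (by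
    rw [← List.length_pos_iff, List.length_replicate]
    exact hn) (p := (z.re - n * z.im, z.im))
    (by rw [List.length_replicate]; exact ⟨h1.le, h2.le, h3.le⟩)
  rw [unfoldWord_replicate_false] at hmem
  simpa using hmem

theorem planePoint_mem_fibTriangle {n : ℕ} (hn : 1 ≤ n) {z : ℂ} (hz : z ∈ openFibTriangle n) :
    planePoint z.re z.im ∈ fibTriangle n := by
  obtain ⟨hre, him⟩ := mem_Icc_of_mem_openFibTriangle hn hz
  rw [mem_fibTriangle_iff hn, planePoint_zero _ hre, planePoint_one _ him]
  exact ⟨hz.1.le, hz.2.1.le, hz.2.2.le⟩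

/-- The mediant of the three vertices of `fibTriangle n`. -/
noncomputable def fibMediant (n : ℕ) : ℂ :=
  ⟨(n + 1 : ℝ) / (Nat.fib n + Nat.fib (n + 1) + 1), 1 / (Nat.fib n + Nat.fib (n + 1) + 1)⟩

theorem fibMediant_mem (n : ℕ) : fibMediant n ∈ openFibTriangle n := by
  have hd : (0 : ℝ) < Nat.fib n + Nat.fib (n + 1) + 1 := by positivity
  have h : (fibMediant n).re - n * (fibMediant n).im =
      1 / (Nat.fib n + Nat.fib (n + 1) + 1) := by
    simp only [fibMediant]
    ring
  refine ⟨by rw [h]; positivity, by simp only [fibMediant]; positivity, ?_⟩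
  rw [h]
  simp only [fibMediant]
  rw [← add_mul, mul_one_div, div_lt_one hd]
  linarith

theorem isClosed_fibTriangle {n : ℕ} (hn : 1 ≤ n) : IsClosed (fibTriangle n) := by
  obtain ⟨σ, ⟨hσ, -⟩, hr⟩ := isZRetract_fibTriangle hn
  rw [← hr]
  exact (isCompact_range (continuous_pi fun i => (hσ i).1)).isClosed

/-- Each point of the triangle is approached along the segment from the mediant. -/
theorem fibTriangle_subset_closure {n : ℕ} (hn : 1 ≤ n) :
    fibTriangle n ⊆ closure ((fun z : ℂ => planePoint z.re z.im) '' openFibTriangle n) := by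
  intro x hx
  rw [mem_fibTriangle_iff hn] at hx
  obtain ⟨h1, h2, h3⟩ := hx
  obtain ⟨m1, m2, m3⟩ := fibMediant_mem n
  simp only at h1 h2 h3
  let γ : ℝ → ℂ := fun t =>
    ⟨x 0 + t * ((fibMediant n).re - x 0), x 1 + t * ((fibMediant n).im - x 1)⟩
  have hγ : Continuous fun t => planePoint (γ t).re (γ t).im :=
    continuous_planePoint.comp (f := fun t => ((γ t).re, (γ t).im))
      (Continuous.prodMk (by simp only [γ]; fun_prop) (by simp only [γ]; fun_prop))
  have h0 : planePoint (γ 0).re (γ 0).im = x := by simp [γ, planePoint_coe]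
  have htend : Filter.Tendsto (fun t => planePoint (γ t).re (γ t).im)
      (nhdsWithin 0 (Ioi 0)) (nhds x) := by
    have := (hγ.tendsto 0).mono_left (nhdsWithin_le_nhds (s := Ioi (0 : ℝ)))
    rwa [h0] at this
  refine mem_closure_of_tendsto htend ?_
  filter_upwards [Ioo_mem_nhdsGT one_pos] with t ht
  have ht0 := ht.1
  have ht1 : 0 ≤ 1 - t := by linarith [ht.2]
  refine ⟨γ t, ⟨?_, ?_, ?_⟩, rfl⟩ <;> simp only [γ]
  · linarith [mul_pos ht0 m1, mul_nonneg ht1 h1]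
  · linarith [mul_pos ht0 m2, mul_nonneg ht1 h2]
  · linarith [mul_lt_mul_of_pos_left m3 ht0, mul_le_mul_of_nonneg_left h3 ht1]

theorem isClosedDomain_fibTriangle {n : ℕ} (hn : 1 ≤ n) : IsClosedDomain (fibTriangle n) := by
  refine Subset.antisymm (closure_minimal interior_subset (isClosed_fibTriangle hn)) ?_
  refine (fibTriangle_subset_closure hn).trans (closure_mono ?_)
  refine Subset.trans (b := (fun x : Cube 2 => (⟨x 0, x 1⟩ : ℂ)) ⁻¹' openFibTriangle n) ?_ ?_
  · rintro _ ⟨z, hz, rfl⟩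
    obtain ⟨hre, him⟩ := mem_Icc_of_mem_openFibTriangle hn hz
    simpa only [mem_preimage, planePoint_zero _ hre, planePoint_one _ him] using hz
  · refine interior_maximal (fun x hx => ?_) ((isOpen_openFibTriangle n).preimage ?_)
    · rw [mem_fibTriangle_iff hn]
      exact ⟨hx.1.le, hx.2.1.le, hx.2.2.le⟩
    · exact continuous_complex_mk.comp (f := fun x : Cube 2 => ((x 0 : ℝ), (x 1 : ℝ)))
        (by fun_prop)

/-! ### Retractions of the free algebra as sections of a planar map -/

/-- A homomorphism between algebras of functions, the first consisting of continuous functions on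
a compact space, is composition with a map of the underlying spaces. -/
theorem MVHom.exists_eq_comp {X Y : Type*} [TopologicalSpace X] [CompactSpace X]
    {S : MVSubalgebra (X → unitInterval)} (hc : ∀ f ∈ S, Continuous f)
    (h : MVHom S (Y → unitInterval)) : ∃ σ : Y → X, ∀ f y, h.toFun f y = f.1 (σ y) := by
  choose σ hσ using fun y => MVHom.exists_eq_eval hc ((MVHom.eval y).comp h)
  exact ⟨σ, fun f y => hσ y f⟩

theorem continuous_of_mem_McNOn {n : ℕ} {P : Set (Cube n)} :
    ∀ f ∈ McNOn P, Continuous f := by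
  rintro _ ⟨f, hf, rfl⟩
  exact hf.1.comp continuous_subtype_val

/-- Restriction of McNaughton functions to `P`. -/
def McNOn.restrict {n : ℕ} (P : Set (Cube n)) : MVHom (McN n) (McNOn P) where
  toFun f := ⟨P.domRestrict f.1, f.1, f.2, rfl⟩
  map_zero := rfl
  map_oplus _ _ := rfl
  map_neg _ := rfl

/-- The `i`-th coordinate function, as a McNaughton function. -/
def McN.coord {n : ℕ} (i : Fin n) : McN n := ⟨fun x => x i, IsMcNaughton.coord i⟩

/-- If `A ≅ M(P)` is realised by a homomorphism `g ↦ g ∘ τ`, then the retractions onto `A` are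
given by the sections of `τ` over `P` with McNaughton components. -/
theorem exists_section_of_mem_retractionsOnto {n : ℕ} {P : Set (Cube n)} {A : MVSubalgebra (McN n)}
    {e : MVHom A (McNOn P)} (he : Function.Bijective e.toFun) {τ : Cube n → P}
    (hτ : ∀ g x, ((e.inverse he).toFun g).1.1 x = g.1 (τ x)) {ε : MVHom (McN n) (McN n)}
    (hε : ε ∈ retractionsOnto A) :
    ∃ F : Cube n → Cube n, (∀ i, IsMcNaughton fun x => F x i) ∧ (∀ u : P, τ (F u) = u) ∧
      ∀ f x, (ε.toFun f).1 x = f.1 (F (τ x)) := by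
  have hmem : ∀ f, ε.toFun f ∈ A := fun f => by
    have : ε.toFun f ∈ (A : Set (McN n)) := hε.2 ▸ mem_range_self f
    exact this
  let ε' : MVHom (McN n) A :=
    ⟨fun f => ⟨ε.toFun f, hmem f⟩, Subtype.ext ε.map_zero, fun f g => Subtype.ext (ε.map_oplus f g),
      fun f => Subtype.ext (ε.map_neg f)⟩
  obtain ⟨s, hs⟩ := MVHom.exists_eq_comp (S := McN n) (fun f hf => hf.1)
    ((MVHom.subtype (McNOn P)).comp (e.comp ε'))
  have hs : ∀ f u, (e.toFun (ε'.toFun f)).1 u = f.1 (s u) := hs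
  choose F hF hFs using fun i => (e.toFun (ε'.toFun (McN.coord i))).2
  have hsF : ∀ u, s u = fun i => F i u := by
    intro u
    funext i
    have := hs (McN.coord i) u
    rw [hFs i] at this
    exact this.symm
  have hε' : ∀ f x, (ε.toFun f).1 x = f.1 (s (τ x)) := by
    intro f x
    rw [← hs, ← hτ, MVHom.inverse_apply]
  refine ⟨fun x i => F i x, hF, fun u => ?_, fun f x => ?_⟩
  · change τ (fun i => F i u) = u
    rw [← hsF u]
    -- the retraction fixes the elements of `A`, so coordinates cannot tell `τ (s u)` from `u`
    have hfix : ∀ a : A, ε'.toFun a.1 = a := by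
      intro a
      have ha : a.1 ∈ range ε.toFun := hε.2 ▸ a.2
      obtain ⟨f, hf⟩ := ha
      apply Subtype.ext
      change ε.toFun a.1 = a.1
      rw [← hf, hε.1]
    have hg : ∀ g : McNOn P, g.1 (τ (s u)) = g.1 u := by
      intro g
      rw [← hτ, ← hs, hfix, MVHom.apply_inverse]
    exact Subtype.ext (funext fun i => hg ((McNOn.restrict P).toFun (McN.coord i)))
  · rw [hε', hsF]

/-- The point of the complex plane with the coordinates of `x`. -/
def Cube.toComplex (x : Cube 2) : ℂ := ⟨x 0, x 1⟩

theorem Cube.toComplex_injective : Function.Injective Cube.toComplex := by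
  intro x y h
  rw [← planePoint_coe x, ← planePoint_coe y]
  have h0 : (x 0 : ℝ) = y 0 := congrArg Complex.re h
  have h1 : (x 1 : ℝ) = y 1 := congrArg Complex.im h
  rw [h0, h1]

theorem continuous_toComplex : Continuous Cube.toComplex :=
  continuous_complex_mk.comp (f := fun x : Cube 2 => ((x 0 : ℝ), (x 1 : ℝ))) (by fun_prop)

theorem toComplex_planePoint {z : ℂ} (hz : z.re ∈ Icc (0 : ℝ) 1 ∧ z.im ∈ Icc (0 : ℝ) 1) :
    (planePoint z.re z.im).toComplex = z :=
  Complex.ext (planePoint_zero z.im hz.1) (planePoint_one z.re hz.2)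

theorem continuous_planePoint_complex : Continuous fun z : ℂ => planePoint z.re z.im :=
  continuous_planePoint.comp (f := fun z : ℂ => (z.re, z.im)) (by fun_prop)

theorem isPiecewiseAffineOn_of_isMcNaughton {F : Cube 2 → Cube 2}
    (hF : ∀ i, IsMcNaughton fun x => F x i) {Ω : Set ℂ}
    (hΩ : ∀ z ∈ Ω, z.re ∈ Icc (0 : ℝ) 1 ∧ z.im ∈ Icc (0 : ℝ) 1) :
    IsPiecewiseAffineOn (fun z => (F (planePoint z.re z.im)).toComplex) Ω := by
  classical
  obtain ⟨-, L, hL⟩ := hF 0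
  obtain ⟨-, K, hK⟩ := hF 1
  let lin : (Fin 2 → ℤ) → (Fin 2 → ℤ) → ℂ →ₗ[ℝ] ℂ := fun p q =>
    { toFun := fun z => ⟨p 0 * z.re + p 1 * z.im, q 0 * z.re + q 1 * z.im⟩
      map_add' := fun z w => by apply Complex.ext <;> simp <;> ring
      map_smul' := fun t z => by apply Complex.ext <;> simp <;> ring }
  refine ⟨(L ×ˢ K).image fun r => (lin r.1.1 r.2.1, ⟨r.1.2, r.2.2⟩), fun z hz => ?_⟩
  obtain ⟨p, hp, hfp⟩ := hL (planePoint z.re z.im)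
  obtain ⟨q, hq, hfq⟩ := hK (planePoint z.re z.im)
  refine ⟨_, Finset.mem_image_of_mem _
    (Finset.mem_product.2 (⟨hp, hq⟩ : (p, q).1 ∈ L ∧ (p, q).2 ∈ K)), ?_⟩
  obtain ⟨h0, h1⟩ := hΩ z hz
  rw [Fin.sum_univ_two, planePoint_zero _ h0, planePoint_one _ h1] at hfp hfq
  exact Complex.ext hfp hfq

/-- The points of the `n`-cube whose coordinates are multiples of `1 / d` number at most
`(d + 1) ^ n`. -/
theorem encard_rational_points_le {n d : ℕ} (hd : 0 < d) :
    {x : Cube n | ∀ i, ∃ k : ℤ, (d : ℝ) * x i = k}.encard ≤ ((d + 1) ^ n : ℕ) := by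
  have hd' : (0 : ℝ) < d := by exact_mod_cast hd
  have hsub : {x : Cube n | ∀ i, ∃ k : ℤ, (d : ℝ) * x i = k} ⊆
      range fun (k : Fin n → Fin (d + 1)) i => clamp ((k i : ℕ) / d : ℝ) := by
    intro x hx
    choose k hk using hx
    have hk0 : ∀ i, 0 ≤ k i := fun i => by
      have : (0 : ℝ) ≤ k i := by rw [← hk i]; exact mul_nonneg hd'.le (x i).2.1
      exact_mod_cast this
    have hkd : ∀ i, k i ≤ d := fun i => by
      have : (k i : ℝ) ≤ d := by
        rw [← hk i]
        exact mul_le_of_le_one_right hd'.le (x i).2.2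
      exact_mod_cast this
    refine ⟨fun i => ⟨(k i).toNat, by have := hkd i; have := hk0 i; omega⟩, funext fun i => ?_⟩
    have h1 : (((k i).toNat : ℕ) : ℝ) = k i := by
      exact_mod_cast Int.toNat_of_nonneg (hk0 i)
    simp only [h1]
    rw [← hk i, mul_div_cancel_left₀ _ hd'.ne', clamp_coe]
  refine (encard_le_encard hsub).trans ?_
  rw [← image_univ]
  refine (encard_image_le _ _).trans ?_
  rw [encard_univ, ENat.card_eq_coe_fintype_card]
  simp

/-- Retractions onto `A ≅ M(P)` are sections of one map `τ`, and by rigidity such a section is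
determined by its value at any one rational point inside `P`; the denominator of this value divides
that of the point. -/
theorem retractMultiplicity_le {P : Set (Cube 2)} (hP : IsClosed P) {Ω : Set ℂ} (hΩ : IsOpen Ω)
    (hconn : IsPreconnected Ω) (hsq : ∀ z ∈ Ω, z.re ∈ Icc (0 : ℝ) 1 ∧ z.im ∈ Icc (0 : ℝ) 1)
    (hΩP : ∀ z ∈ Ω, planePoint z.re z.im ∈ P)
    (hdense : P ⊆ closure ((fun z : ℂ => planePoint z.re z.im) '' Ω)) {c : ℂ} (hc : c ∈ Ω)
    {d : ℕ} (hd : 0 < d) {a b : ℤ} (ha : (d : ℝ) * c.re = a) (hb : (d : ℝ) * c.im = b)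
    {A : MVSubalgebra (McN 2)} (hA : MVIsomorphic A (McNOn P)) :
    retractMultiplicity A ≤ ((d + 1) ^ 2 : ℕ) := by
  obtain ⟨e, he⟩ := hA
  have : CompactSpace P := isCompact_iff_compactSpace.1 hP.isCompact
  obtain ⟨τ, hτ⟩ := MVHom.exists_eq_comp (S := McNOn P) continuous_of_mem_McNOn
    ((MVHom.subtype (McN 2)).comp ((MVHom.subtype A).comp (e.inverse he)))
  have hτ : ∀ g x, ((e.inverse he).toFun g).1.1 x = g.1 (τ x) := hτ
  choose! F hF hsec hεF using fun (ε : MVHom (McN 2) (McN 2)) (hε : ε ∈ retractionsOnto A) =>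
    exists_section_of_mem_retractionsOnto he hτ hε
  refine (encard_le_encard_of_injOn (f := fun ε => F ε (planePoint c.re c.im))
    (t := {x : Cube 2 | ∀ i, ∃ k : ℤ, (d : ℝ) * x i = k}) ?_ ?_).trans
    (encard_rational_points_le hd)
  · intro ε hε i
    refine (isMcNaughton_iff.1 (hF ε hε i)).exists_int_eq (d := d) ![a, b] fun j => ?_
    fin_cases j
    · simpa [planePoint_zero _ (hsq c hc).1] using ha
    · simpa [planePoint_one _ (hsq c hc).2] using hb
  · intro ε hε ε' hε' heq
    have hcont : ∀ ε ∈ retractionsOnto A, Continuous (F ε) := fun ε hε =>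
      continuous_pi fun i => (hF ε hε i).1
    have hcS : ∀ ε ∈ retractionsOnto A,
        Continuous fun z : ℂ => (F ε (planePoint z.re z.im)).toComplex := fun ε hε =>
      continuous_toComplex.comp ((hcont ε hε).comp continuous_planePoint_complex)
    have hinv : ∀ ε ∈ retractionsOnto A, ∀ z ∈ Ω, (fun w : ℂ =>
        (τ (planePoint w.re w.im) : Cube 2).toComplex)
          (F ε (planePoint z.re z.im)).toComplex = z := by
      intro ε hε z hz
      have h1 : ∀ x : Cube 2, planePoint x.toComplex.re x.toComplex.im = x := planePoint_coe
      simp only [h1]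
      rw [hsec ε hε ⟨planePoint z.re z.im, hΩP z hz⟩]
      exact toComplex_planePoint (hsq z hz)
    have hEq := (isPiecewiseAffineOn_of_isMcNaughton (hF ε hε) hsq).eqOn_of_leftInverse
      (T := fun w : ℂ => (τ (planePoint w.re w.im) : Cube 2).toComplex)
      (hcS ε hε).continuousOn (hcS ε' hε').continuousOn (hinv ε hε) (hinv ε' hε') hΩ hconn hc
      (congrArg Cube.toComplex heq)
    have hP' : EqOn (F ε) (F ε') P := by
      refine (EqOn.closure ?_ (hcont ε hε) (hcont ε' hε')).mono hdense
      rintro _ ⟨z, hz, rfl⟩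
      exact Cube.toComplex_injective (hEq hz)
    apply MVHom.ext
    funext f
    apply Subtype.ext
    funext x
    rw [hεF ε hε, hεF ε' hε', hP' (τ x).2]

/-! ### The number of generators -/

/-- The subalgebra on which two homomorphisms agree. -/
def MVHom.equalizer {A B : Type*} [MVAlgebra A] [MVAlgebra B] (f g : MVHom A B) :
    MVSubalgebra A where
  carrier := {a | f.toFun a = g.toFun a}
  zero_mem := by
    change f.toFun zero = g.toFun zero
    rw [f.map_zero, g.map_zero]
  oplus_mem {x y} hx hy := by
    change f.toFun (oplus x y) = g.toFun (oplus x y)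
    rw [f.map_oplus, g.map_oplus, show f.toFun x = g.toFun x from hx,
      show f.toFun y = g.toFun y from hy]
  neg_mem {x} hx := by
    change f.toFun (neg x) = g.toFun (neg x)
    rw [f.map_neg, g.map_neg, show f.toFun x = g.toFun x from hx]

/-- By McNaughton's theorem two generators suffice. One does not: a continuous function on a disc
takes equal values at two different points, and so does all that it generates. -/
theorem minGenerators_eq_two {B : Type*} [MVAlgebra B] {P : Set (Cube 2)}
    (hB : MVIsomorphic B (McNOn P)) {Ω : Set ℂ} (hΩ : IsOpen Ω) (hne : Ω.Nonempty)
    (hsq : ∀ z ∈ Ω, z.re ∈ Icc (0 : ℝ) 1 ∧ z.im ∈ Icc (0 : ℝ) 1)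
    (hΩP : ∀ z ∈ Ω, planePoint z.re z.im ∈ P) : minGenerators B = 2 := by
  classical
  obtain ⟨e, he⟩ := hB
  have hlower : ∀ s : Finset B, MVGenerates (s : Set B) → 2 ≤ s.card := by
    intro s hs
    by_contra hlt
    obtain ⟨b, hb⟩ : ∃ b : B, ∀ x ∈ s, x = b := by
      rcases s.eq_empty_or_nonempty with rfl | ⟨b, hb⟩
      · exact ⟨zero, by simp⟩
      · exact ⟨b, fun x hx => Finset.card_le_one.1 (by omega) x hx b hb⟩
    obtain ⟨f, hf, hfb⟩ := (e.toFun b).2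
    obtain ⟨c, hc⟩ := hne
    obtain ⟨r, hr, hball⟩ := Metric.nhds_basis_closedBall.mem_iff.1 (hΩ.mem_nhds hc)
    obtain ⟨v, hv, hfv⟩ := exists_eq_antipodal (c := c)
      (continuous_subtype_val.comp (hf.1.comp continuous_planePoint_complex)).continuousOn hr
    have h1 : c + v ∈ Ω := hball (by simp [hv])
    have h2 : c - v ∈ Ω := hball (by simp [hv])
    let u₁ : P := ⟨planePoint (c + v).re (c + v).im, hΩP _ h1⟩
    let u₂ : P := ⟨planePoint (c - v).re (c - v).im, hΩP _ h2⟩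
    let ev : P → MVHom B unitInterval := fun u =>
      (MVHom.eval u).comp ((MVHom.subtype (McNOn P)).comp e)
    have hall := hs ((ev u₁).equalizer (ev u₂)) (fun x hx => by
      rw [hb x hx]
      change (e.toFun b).1 u₁ = (e.toFun b).1 u₂
      rw [hfb]
      exact Subtype.ext hfv)
    have hu : u₁.1 = u₂.1 := funext fun i => by
      obtain ⟨x, hx⟩ := he.2 ((McNOn.restrict P).toFun (McN.coord i))
      have h : (e.toFun x).1 u₁ = (e.toFun x).1 u₂ := hall x
      rw [hx] at h
      exact h
    have hz : c + v = c - v := by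
      rw [← toComplex_planePoint (hsq _ h1), ← toComplex_planePoint (hsq _ h2)]
      exact congrArg Cube.toComplex hu
    have hv0 : v = 0 := self_eq_neg.1 (by linear_combination hz)
    rw [hv0, norm_zero] at hv
    exact hr.ne hv
  let κ : MVHom (McN 2) B := (e.inverse he).comp (McNOn.restrict P)
  let s : Finset B := Finset.univ.image fun i : Fin 2 => κ.toFun (McN.coord i)
  have hs : MVGenerates (s : Set B) := by
    intro S hS b
    obtain ⟨f, hf, hfb⟩ := (e.toFun b).2
    have hb : b = κ.toFun ⟨f, hf⟩ := by
      rw [← e.inverse_apply he b]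
      exact congrArg (e.inverse he).toFun (Subtype.ext hfb)
    have hcoord : ∀ i, McN.coord i ∈ κ.comap S := fun i => hS (by simp [s])
    have hmem := IsMcNaughton.mem_of_coord_mem
      (S := ((MVHom.subtype (McN 2)).comp (MVHom.subtype (κ.comap S))).mvRange)
      (fun i => mem_range_self (⟨McN.coord i, hcoord i⟩ : κ.comap S)) hf
    obtain ⟨g, hg⟩ := hmem
    have : g.1 = (⟨f, hf⟩ : McN 2) := Subtype.ext hg
    rw [hb, ← this]
    exact g.2
  have hcard : s.card ≤ 2 := Finset.card_image_le
  have hle : minGenerators B ≤ s.card := Nat.sInf_le ⟨s, rfl, hs⟩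
  refine le_antisymm (hle.trans hcard) ?_
  obtain ⟨t, ht, htg⟩ := Nat.sInf_mem (s := {k : ℕ | ∃ s : Finset B, s.card = k ∧
    MVGenerates (s : Set B)}) ⟨_, s, rfl, hs⟩
  rw [minGenerators, ← ht]
  exact hlower t htg

/-! ### Retracts of the free algebra given by retractions of the cube -/

/-- Composition with a `ℤ`-map of the cube, as an endomorphism of the free algebra. -/
def McN.precomp {n : ℕ} (σ : Cube n → Cube n) (hσ : ∀ i, IsMcNaughton fun x => σ x i) :
    MVHom (McN n) (McN n) where
  toFun f := ⟨f.1 ∘ σ, IsMcNaughton.comp f.2 hσ⟩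
  map_zero := rfl
  map_oplus _ _ := rfl
  map_neg _ := rfl

theorem McN.precomp_injective {n : ℕ} {σ σ' : Cube n → Cube n}
    {hσ : ∀ i, IsMcNaughton fun x => σ x i} {hσ' : ∀ i, IsMcNaughton fun x => σ' x i}
    (h : McN.precomp σ hσ = McN.precomp σ' hσ') : σ = σ' := by
  funext x i
  have := congrArg (fun ε : MVHom (McN n) (McN n) => (ε.toFun (McN.coord i)).1 x) h
  exact this

/-- `ℤ`-retractions that absorb each other on the right have the same fibres, hence induce
retractions onto the same subalgebra. -/
theorem McN.precomp_mem_retractionsOnto {n : ℕ} {σ σ' : Cube n → Cube n}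
    {hσ : ∀ i, IsMcNaughton fun x => σ x i} {hσ' : ∀ i, IsMcNaughton fun x => σ' x i}
    (hi : ∀ x, σ' (σ' x) = σ' x) (h : ∀ x, σ (σ' x) = σ x) (h' : ∀ x, σ' (σ x) = σ' x) :
    McN.precomp σ' hσ' ∈ retractionsOnto (McN.precomp σ hσ).mvRange := by
  refine ⟨fun f => Subtype.ext (funext fun x => congrArg f.1 (hi x)), Subset.antisymm ?_ ?_⟩
  · rintro _ ⟨f, rfl⟩
    exact ⟨(McN.precomp σ' hσ').toFun f, Subtype.ext (funext fun x => congrArg f.1 (h' x))⟩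
  · rintro _ ⟨f, rfl⟩
    exact ⟨(McN.precomp σ hσ).toFun f, Subtype.ext (funext fun x => congrArg f.1 (h x))⟩

theorem McN.mvRange_precomp_isomorphic {n : ℕ} {σ : Cube n → Cube n}
    {hσ : ∀ i, IsMcNaughton fun x => σ x i} (hi : ∀ x, σ (σ x) = σ x) :
    MVIsomorphic (McN.precomp σ hσ).mvRange (McNOn (range σ)) := by
  refine ⟨(McNOn.restrict (range σ)).comp (MVHom.subtype _), ?_, ?_⟩
  · rintro ⟨_, f, rfl⟩ ⟨_, g, rfl⟩ h
    apply Subtype.ext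
    apply Subtype.ext
    funext x
    have := congrFun (congrArg Subtype.val h) ⟨σ x, mem_range_self x⟩
    change f.1 (σ (σ x)) = g.1 (σ (σ x)) at this
    rw [hi] at this
    exact this
  · rintro ⟨_, f, hf, rfl⟩
    refine ⟨⟨(McN.precomp σ hσ).toFun ⟨f, hf⟩, mem_range_self _⟩, Subtype.ext ?_⟩
    funext u
    obtain ⟨_, x, rfl⟩ := u
    exact congrArg f (hi x)

theorem mvIndex_eq_of_minGenerators {B : Type*} [MVAlgebra B] {k : ℕ} (h : minGenerators B = k) :
    mvIndex B = ⨆ (A : MVSubalgebra (McN k)) (_ : IsRetract A) (_ : MVIsomorphic A B),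
      retractMultiplicity A := by
  subst h
  rfl

/-! ### The index of the algebra of a Fibonacci triangle -/

section Fibonacci

variable {n : ℕ} {B : Type*} [MVAlgebra B]

theorem minGenerators_eq_two_of_fibTriangle (hn : 1 ≤ n)
    (hB : MVIsomorphic B (McNOn (fibTriangle n))) : minGenerators B = 2 :=
  minGenerators_eq_two hB (isOpen_openFibTriangle n) ⟨_, fibMediant_mem n⟩
    (fun _ hz => mem_Icc_of_mem_openFibTriangle hn hz)
    fun _ hz => planePoint_mem_fibTriangle hn hz

theorem mvIndex_ne_top_of_fibTriangle (hn : 1 ≤ n)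
    (hB : MVIsomorphic B (McNOn (fibTriangle n))) : mvIndex B ≠ ⊤ := by
  rw [mvIndex_eq_of_minGenerators (minGenerators_eq_two_of_fibTriangle hn hB)]
  have hd : ((Nat.fib n + Nat.fib (n + 1) + 1 : ℕ) : ℝ) ≠ 0 := by positivity
  refine ne_top_of_le_ne_top (ENat.natCast_ne_top ((Nat.fib n + Nat.fib (n + 1) + 1 + 1) ^ 2))
    (iSup_le fun A => iSup_le fun _ => iSup_le fun hA => ?_)
  refine retractMultiplicity_le (isClosed_fibTriangle hn) (isOpen_openFibTriangle n)
    (convex_openFibTriangle n).isPreconnected (fun _ hz => mem_Icc_of_mem_openFibTriangle hn hz)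
    (fun _ hz => planePoint_mem_fibTriangle hn hz) (fibTriangle_subset_closure hn)
    (fibMediant_mem n) (Nat.succ_pos _) (a := n + 1) (b := 1) ?_ ?_ (hA.trans hB)
  · push_cast at hd ⊢
    exact mul_div_cancel₀ _ hd
  · push_cast at hd ⊢
    exact mul_div_cancel₀ _ hd

/-- The subalgebra of functions constant on the fibres of the `n`-fold fold. -/
noncomputable def fibRetract (n : ℕ) (hn : 1 ≤ n) : MVSubalgebra (McN 2) :=
  (McN.precomp (foldRetraction (List.replicate n false)) (isZRetraction_foldRetraction (by
    rw [← List.length_pos_iff, List.length_replicate]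
    exact hn)).1).mvRange

theorem fibRetract_isomorphic (hn : 1 ≤ n) :
    MVIsomorphic (fibRetract n hn) (McNOn (fibTriangle n)) := by
  have hl : List.replicate n false ≠ [] := by
    rw [← List.length_pos_iff, List.length_replicate]
    exact hn
  have := McN.mvRange_precomp_isomorphic (hσ := (isZRetraction_foldRetraction hl).1)
    (isZRetraction_foldRetraction hl).2
  rw [range_foldRetraction_replicate hn] at this
  exact this

/-- Each of the `2 ^ n` words of length `n` contributes a retraction. -/
theorem two_pow_le_retractMultiplicity_fibRetract (hn : 1 ≤ n) :
    (2 : ℕ∞) ^ n ≤ retractMultiplicity (fibRetract n hn) := by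
  have hne : ∀ {l : List Bool}, l.length = n → l ≠ [] := fun hl => by
    rw [← List.length_pos_iff, hl]
    exact hn
  let ε : List.Vector Bool n → MVHom (McN 2) (McN 2) := fun l =>
    McN.precomp (foldRetraction l.1) (isZRetraction_foldRetraction (hne l.2)).1
  have hε : Function.Injective ε := fun l l' h => Subtype.ext
    (foldRetraction_injective (hne l.2) (l.2.trans l'.2.symm) (McN.precomp_injective h))
  have hcard : ENat.card (List.Vector Bool n) = 2 ^ n := by
    rw [ENat.card_eq_coe_fintype_card, card_vector, Fintype.card_bool]
    norm_cast
  rw [← hcard]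
  refine hε.encard_range.trans (encard_le_encard ?_)
  rintro _ ⟨l, rfl⟩
  have hr : (List.replicate n false).length = n := List.length_replicate
  exact McN.precomp_mem_retractionsOnto (isZRetraction_foldRetraction (hne l.2)).2
    (foldRetraction_comp (hne l.2) (hr.trans l.2.symm))
    (foldRetraction_comp (hne hr) (l.2.trans hr.symm))

theorem isRetract_fibRetract (hn : 1 ≤ n) : IsRetract (fibRetract n hn) := by
  rw [IsRetract, ← encard_pos]
  exact lt_of_lt_of_le (by positivity) (two_pow_le_retractMultiplicity_fibRetract hn)

theorem two_pow_le_mvIndex_of_fibTriangle (hn : 1 ≤ n)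
    (hB : MVIsomorphic B (McNOn (fibTriangle n))) : (2 : ℕ∞) ^ n ≤ mvIndex B := by
  rw [mvIndex_eq_of_minGenerators (minGenerators_eq_two_of_fibTriangle hn hB)]
  exact (two_pow_le_retractMultiplicity_fibRetract hn).trans
    (le_iSup₂_of_le (fibRetract n hn) (isRetract_fibRetract hn)
      (le_iSup_of_le ((fibRetract_isomorphic hn).trans hB.symm) le_rfl))

theorem maxSpecIsClosedDomain_of_fibTriangle (hn : 1 ≤ n)
    (hB : MVIsomorphic B (McNOn (fibTriangle n))) : MaxSpecIsClosedDomain 2 B := by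
  refine ⟨fibTriangle n, isZRetract_fibTriangle hn, hB, isClosedDomain_fibTriangle hn, ?_⟩
  obtain ⟨e, he⟩ := hB
  have : CompactSpace (fibTriangle n) :=
    isCompact_iff_compactSpace.1 (isClosed_fibTriangle hn).isCompact
  refine nonempty_maxSpec_homeomorph (e := (MVHom.subtype (McNOn (fibTriangle n))).comp e)
    (fun b => continuous_of_mem_McNOn _ (e.toFun b).2) (Subtype.val_injective.comp he.1) ?_
  rintro x _ ⟨V, hV, rfl⟩ hx
  obtain ⟨f, hf, hfx, hfV⟩ := exists_isMcNaughton_ne_zero hV hx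
  obtain ⟨b, hb⟩ := he.2 ((McNOn.restrict (fibTriangle n)).toFun ⟨f, hf⟩)
  have hval : ∀ y, (e.toFun b).1 y = f y := fun y => by
    rw [hb]
    rfl
  refine ⟨b, ?_, fun y hy => ?_⟩
  · change (e.toFun b).1 x ≠ 0
    rwa [hval]
  · change (e.toFun b).1 y = 0
    rw [hval]
    exact hfV y hy

end Fibonacci

theorem mainTheorem5 :
    (∀ j : ℕ, 1 ≤ j → ∃ A : MVSubalgebra (McN 2), IsRetract A ∧
      MaxSpecIsClosedDomain 2 A ∧ (j : ℕ∞) < mvIndex A ∧ mvIndex A ≠ ⊤) ∧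
    (∀ n : ℕ, 1 ≤ n → IsZRetract (fibTriangle n) ∧
      (2 : ℕ∞) ^ n ≤ mvIndex (McNOn (fibTriangle n)) ∧ mvIndex (McNOn (fibTriangle n)) ≠ ⊤) := by
  refine ⟨fun j hj => ?_, fun n hn => ?_⟩
  · have hiso := fibRetract_isomorphic hj
    refine ⟨fibRetract j hj, isRetract_fibRetract hj,
      maxSpecIsClosedDomain_of_fibTriangle hj hiso, ?_, mvIndex_ne_top_of_fibTriangle hj hiso⟩
    refine lt_of_lt_of_le ?_ (two_pow_le_mvIndex_of_fibTriangle hj hiso)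
    exact_mod_cast Nat.lt_two_pow_self
  · exact ⟨isZRetract_fibTriangle hn, two_pow_le_mvIndex_of_fibTriangle hn (MVIsomorphic.refl _),
      mvIndex_ne_top_of_fibTriangle hn (MVIsomorphic.refl _)⟩
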